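/- Let $\mathcal Y$ be a finite set and let $\mathcal P(\mathcal Y)$ be the set of probability mass functions on $\mathcal Y$. For $p,q\in\mathcal P(\mathcal Y)$ let $D(p\|q)=\sum_y p(y)\log\frac{p(y)}{q(y)}$ and $B(p,q)=-\log\sum_y p(y)^{1/2}q(y)^{1/2}$. For each $M\ge 3$ consider $n$ i.i.d. vector observations with $M$ independent coordinates in $\mathcal Y$. Let $\mu\ne\pi$ be elements of $\mathcal P(\mathcal Y)$, both of full support. Under hypothesis $i\in\{1,\dots,M\}$ the $i$-th coordinate has distribution $\mu$ and all the others have distribution $\pi$; under the null hypothesis $0$ all coordinates have distribution $\pi$. Write $\mathbb P_i$, $i=0,\dots,M$, for the law of the data $y^{Mn}$. Let $\gamma_j$ be the empirical distribution of the $j$-th coordinate of the data, and $$U_i=\sum_{j\ne i}D\Big(\gamma_j\,\Big\|\,\tfrac{1}{M-1}\sum_{k\ne i}\gamma_k\Big),\qquad i=1,\dots,M.$$ Let $\delta$ be the test, not depending on $(\mu,\pi)$, that decides for a minimizer $i\in\{1,\dots,M\}$ of $U_i$ (ties broken arbitrarily) if $\max_{j\neq k}(U_j-U_k)>\lambda_n$,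 and for the null hypothesis $0$ otherwise, where the threshold $\lambda_n$ (which may depend on $M$) satisfies $\lambda_n=O(\frac{\log n}{n})$ as $n\to\infty$ for each fixed $M\ge3$. Put $C_\pi=-\log\min_{y}\pi(y)<\infty$. Then: (1) For each $M\ge 3$ and each $i=1,\dots,M$, the limit below exists and $$\lim_{n\to\infty}-\frac1n\log\mathbb P_i\{\delta\ne i\}\ \ge\ \min_{\substack{q\in\mathcal P(\mathcal Y)\\ D(q\|\pi)\le\frac{1}{M-1}(2B(\mu,\pi)+C_\pi)}}2B(\mu,q),$$ where the minimum is attained. (2) As $M\to\infty$, the lower bound in (1) converges to $2B(\mu,\pi)$, and $$\lim_{M\to\infty}\lim_{n\to\infty}-\frac1n\log\mathbb P_i\{\delta\ne i\}=2B(\mu,\pi),$$ uniformly in the index $i\in\{1,\dots,M\}$. (3) For each $M\ge3$, if moreover $\lambda_n\ge c\,\frac{\log n}{n}$ for some constant $c>0$ and all large $n$, then $\lim_{n\to\infty}\mathbb P_0\{\delta\ne0\}=0$. -/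

import Mathlib

open Filter Topology Asymptotics

noncomputable section

namespace OutlierTest

variable {Y : Type*} [Fintype Y] [DecidableEq Y]

/-- Relative entropy `D(p ‖ q)` (natural logarithm) of probability mass functions on a finite
alphabet. It is only used for pairs with `q y = 0 → p y = 0`, where it is finite and the real
conventions `0 * log _ = 0` are the usual ones. -/
def relEntropy (p q : Y → ℝ) : ℝ := ∑ y, p y * Real.log (p y / q y)

/-- Bhattacharyya distance `B(p, q)`. It is only used for `p` of full support, where the sum is
positive. -/
def bhattacharyya (p q : Y → ℝ) : ℝ := -Real.log (∑ y, √(p y) * √(q y))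

/-- `C_π = - log (min_y π y)`. -/
def logInvMin (π : Y → ℝ) : ℝ := -Real.log (⨅ y, π y)

/-- The empirical distribution of the sequence `s` of length `n`. -/
def empirical {n : ℕ} (s : Fin n → Y) (a : Y) : ℝ :=
  (Finset.card {k | s k = a} : ℝ) / n

/-- The average of the empirical distributions of all coordinates but the `i`-th one.
The observed data are `y : Fin M → Fin n → Y`, with `y j k` the `j`-th coordinate of the `k`-th
observation. -/
def avgExcept {M n : ℕ} (y : Fin M → Fin n → Y) (i : Fin M) (a : Y) : ℝ :=
  (∑ k ∈ Finset.univ.erase i, empirical (y k) a) / ((M : ℝ) - 1)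

/-- The statistic `U_i`: the sum over `j ≠ i` of `D(γ_j ‖ (∑_{k ≠ i} γ_k) / (M - 1))`. -/
def stat {M n : ℕ} (y : Fin M → Fin n → Y) (i : Fin M) : ℝ :=
  ∑ j ∈ Finset.univ.erase i, relEntropy (empirical (y j)) (avgExcept y i)

/-- The joint probability mass function of the data. The hypothesis `some i` says that the `i`-th
coordinate is the outlier, and `none` is the null hypothesis. -/
def jointPmf {M n : ℕ} (μ π : Y → ℝ) (h : Option (Fin M)) (y : Fin M → Fin n → Y) : ℝ :=
  ∏ k, ∏ j, if h = some j then μ (y j k) else π (y j k)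

/-- The conditional probability of error `ℙ_h {δ ≠ h}` of a test `δ` under the hypothesis `h`. -/
def errorProb {M n : ℕ} (μ π : Y → ℝ) (δ : (Fin M → Fin n → Y) → Option (Fin M))
    (h : Option (Fin M)) : ℝ :=
  ∑ y with δ y ≠ h, jointPmf μ π h y

/-- `δ` is a version of the null-augmented test with threshold `t`: it decides for a minimizer of
`U_i` (any one, if there are several) if `max_{j ≠ k} (U_j - U_k) > t`, and for the null
hypothesis otherwise. -/
def IsNullAugmentedTest {M n : ℕ} (t : ℝ) (δ : (Fin M → Fin n → Y) → Option (Fin M)) : Prop :=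
  ∀ y : Fin M → Fin n → Y,
    ((∃ j k : Fin M, j ≠ k ∧ t < stat y j - stat y k) →
      ∃ i : Fin M, δ y = some i ∧ ∀ j : Fin M, stat y i ≤ stat y j) ∧
    ((¬ ∃ j k : Fin M, j ≠ k ∧ t < stat y j - stat y k) → δ y = none)

/-- The limit of `-(1/n) log (e n)` exists and is equal to `a`. Positivity of `e n` for large `n`
is included, so that the logarithms are meaningful. -/
def HasExponent (e : ℕ → ℝ) (a : ℝ) : Prop :=
  (∀ᶠ n in atTop, 0 < e n) ∧
    Tendsto (fun n : ℕ => -(1 / (n : ℝ)) * Real.log (e n)) atTop (𝓝 a)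

/-- The values `2 B(μ, q)` over the probability mass functions `q` with
`D(q ‖ π) ≤ (2 B(μ, π) + C_π) / (M - 1)`. -/
def boundValues (μ π : Y → ℝ) (M : ℕ) : Set ℝ :=
  {v | ∃ q ∈ stdSimplex ℝ Y,
    relEntropy q π ≤ 1 / ((M : ℝ) - 1) * (2 * bhattacharyya μ π + logInvMin π) ∧
    v = 2 * bhattacharyya μ q}

/-- The lower bound for the exponent, the minimum of `boundValues`. -/
def exponentBound (μ π : Y → ℝ) (M : ℕ) : ℝ := sInf (boundValues μ π M)

end OutlierTest

end

/-! The error probability depends on the data only through the types of the coordinates, so its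
exponent is a Sanov-type minimum. Let G be the entropy gained by adding the masses T of the
coordinates other than i and k. The identity U_k - U_i = G(γ_i) - G(γ_k) (`divergenceStat_sub`)
makes the gap continuous in the types. Since λ_n → 0, the exponent is the minimum of D(q_i‖μ) +
∑_{j≠i} D(q_j‖π) over types with U_k ≤ U_i for some k ≠ i.

The upper bound on the probability counts types (`sum_productPmf_le`), and compactness absorbs the
threshold (`exists_margin`). For the lower bound, ties U_k = U_i must be perturbed into strict
errors. G is strictly convex in each letter charged by T, so this is possible when T ≠ 0, that is M
≥ 3 (`exists_path_statGap_neg`); a change of measure and Chebyshev's inequality finish.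

At a minimizer, with m_k the mean of the q_j over j ≠ k, the cost is at least D(q_i‖μ) + U_i ≥
D(q_i‖μ) + U_k ≥ D(q_i‖μ) + D(q_i‖m_k) ≥ 2B(μ, m_k), and the compensation identity puts m_k within
O(1/M) of π in divergence (`exponentBound_le_errorExponent`). The exponent never exceeds 2B(μ, π)
(`errorExponent_le`), so both it and the bound tend to 2B(μ, π). Under the null, the gaps are
dominated by a chi-squared statistic of mean O(1/n), and Markov's inequality beats a threshold of
order (log n)/n. -/

namespace OutlierTest

/-! ### Inequalities for relative entropy and the Bhattacharyya distance. -/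

variable {Y : Type*} [Fintype Y]

theorem mul_log_div_eq {a b : ℝ} (h : b = 0 → a = 0) :
    a * Real.log (a / b) = -Real.negMulLog a - a * Real.log b := by
  by_cases ha : a = 0
  · simp [ha]
  · rw [Real.log_div ha (fun hb => ha (h hb)), Real.negMulLog]; ring

theorem relEntropy_eq {p q : Y → ℝ} (h : ∀ y, q y = 0 → p y = 0) :
    relEntropy p q = ∑ y, (-Real.negMulLog (p y) - p y * Real.log (q y)) :=
  Finset.sum_congr rfl fun y _ => mul_log_div_eq (h y)

/-- The squared Hellinger distance is at most the relative entropy. -/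
theorem hellinger_le_relEntropy {p q : Y → ℝ} (hp : p ∈ stdSimplex ℝ Y) (hq : q ∈ stdSimplex ℝ Y)
    (h : ∀ y, q y = 0 → p y = 0) : ∑ y, (√(p y) - √(q y)) ^ 2 ≤ relEntropy p q := by
  -- This is log x ≤ x - 1 at x = √(q/p); the extra terms p - q cancel on summation.
  have key : ∀ y, (√(p y) - √(q y)) ^ 2 + (p y - q y) ≤ p y * Real.log (p y / q y) := by
    intro y
    have hsp := Real.sq_sqrt (hp.1 y)
    have hsq := Real.sq_sqrt (hq.1 y)
    rcases (hp.1 y).eq_or_lt with h0 | h0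
    · rw [← h0]
      simp only [Real.sqrt_zero, zero_mul, zero_sub]
      nlinarith
    · have hq0 : 0 < q y := lt_of_le_of_ne (hq.1 y) fun e => h0.ne' (h y e.symm)
      have hs : 0 < √(p y) := Real.sqrt_pos.2 h0
      have ht : 0 < √(q y) := Real.sqrt_pos.2 hq0
      have h1 := Real.log_le_sub_one_of_pos (div_pos ht hs)
      rw [Real.log_div ht.ne' hs.ne', Real.log_sqrt hq0.le, Real.log_sqrt h0.le] at h1
      rw [Real.log_div h0.ne' hq0.ne']
      have h2 : p y * (√(q y) / √(p y)) = √(p y) * √(q y) := by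
        nth_rw 1 [← hsp]; field_simp
      nlinarith [mul_le_mul_of_nonneg_left h1 h0.le]
  have := Finset.sum_le_sum fun y (_ : y ∈ Finset.univ) => key y
  rw [Finset.sum_add_distrib, Finset.sum_sub_distrib, hp.2, hq.2] at this
  simpa [relEntropy] using this

theorem relEntropy_nonneg {p q : Y → ℝ} (hp : p ∈ stdSimplex ℝ Y) (hq : q ∈ stdSimplex ℝ Y)
    (h : ∀ y, q y = 0 → p y = 0) : 0 ≤ relEntropy p q :=
  (Finset.sum_nonneg fun _ _ => sq_nonneg _).trans (hellinger_le_relEntropy hp hq h)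

theorem relEntropy_self (p : Y → ℝ) : relEntropy p p = 0 := by
  refine Finset.sum_eq_zero fun y _ => ?_
  by_cases h : p y = 0 <;> simp [h]

/-- The relative entropy is at most the chi-squared divergence. -/
theorem relEntropy_le_chiSq {p q : Y → ℝ} (hp : p ∈ stdSimplex ℝ Y) (hq : q ∈ stdSimplex ℝ Y)
    (hq0 : ∀ y, 0 < q y) : relEntropy p q ≤ ∑ y, (p y - q y) ^ 2 / q y := by
  have key : ∀ y, p y * Real.log (p y / q y) ≤ (p y - q y) ^ 2 / q y + (p y - q y) := by
    intro y
    have e : (p y - q y) ^ 2 / q y + (p y - q y) = p y * (p y / q y - 1) := by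
      have := (hq0 y).ne'
      field_simp; ring
    rw [e]
    rcases (hp.1 y).eq_or_lt with h0 | h0
    · simp [← h0]
    · exact mul_le_mul_of_nonneg_left (Real.log_le_sub_one_of_pos (div_pos h0 (hq0 y))) h0.le
  have := Finset.sum_le_sum fun y (_ : y ∈ Finset.univ) => key y
  rw [Finset.sum_add_distrib, Finset.sum_sub_distrib, hp.2, hq.2] at this
  simpa [relEntropy] using this

theorem iInf_pos_of_forall_pos [Nonempty Y] {p : Y → ℝ} (h : ∀ y, 0 < p y) : 0 < ⨅ y, p y := by
  obtain ⟨y, hy⟩ := exists_eq_ciInf_of_finite (f := p)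
  rw [← hy]; exact h y

theorem nonempty_of_mem_stdSimplex {p : Y → ℝ} (hp : p ∈ stdSimplex ℝ Y) : Nonempty Y := by
  by_contra hne
  have := not_nonempty_iff.1 hne
  simpa using hp.2

theorem relEntropy_le_logInvMin {p q : Y → ℝ} (hp : p ∈ stdSimplex ℝ Y)
    (hq0 : ∀ y, 0 < q y) : relEntropy p q ≤ logInvMin q := by
  have := nonempty_of_mem_stdSimplex hp
  have key : ∀ y, p y * Real.log (p y / q y) ≤ p y * logInvMin q := by
    intro y
    rcases (hp.1 y).eq_or_lt with h0 | h0
    · simp [← h0]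
    refine mul_le_mul_of_nonneg_left ?_ h0.le
    have h1 : p y ≤ 1 := hp.2 ▸ Finset.single_le_sum (fun z _ => hp.1 z) (Finset.mem_univ y)
    have h2 : Real.log (⨅ y, q y) ≤ Real.log (q y) :=
      Real.log_le_log (iInf_pos_of_forall_pos hq0) (ciInf_le (Set.finite_range q).bddBelow y)
    rw [Real.log_div h0.ne' (hq0 y).ne', logInvMin]
    linarith [Real.log_nonpos h0.le h1]
  have := Finset.sum_le_sum fun y (_ : y ∈ Finset.univ) => key y
  rwa [← Finset.sum_mul, hp.2, one_mul] at this

theorem sum_sqrt_mul_sqrt_pos {p q : Y → ℝ} (hp0 : ∀ y, 0 < p y) (hq : q ∈ stdSimplex ℝ Y) :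
    0 < ∑ y, √(p y) * √(q y) := by
  refine Finset.sum_pos' (fun y _ => by positivity) ?_
  by_contra! hcon
  have : ∀ y, q y = 0 := by
    intro y
    by_contra hy
    have h1 : 0 < √(p y) * √(q y) :=
      mul_pos (Real.sqrt_pos.2 (hp0 y)) (Real.sqrt_pos.2 (lt_of_le_of_ne (hq.1 y) (Ne.symm hy)))
    exact absurd (hcon y (Finset.mem_univ y)) (not_le.2 h1)
  have h2 := hq.2
  simp [this] at h2

theorem bhattacharyya_nonneg {p q : Y → ℝ} (hp : p ∈ stdSimplex ℝ Y) (hq : q ∈ stdSimplex ℝ Y) :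
    0 ≤ bhattacharyya p q := by
  have : ∑ y, √(p y) * √(q y) ≤ ∑ y, (p y / 2 + q y / 2) := by
    refine Finset.sum_le_sum fun y _ => ?_
    nlinarith [sq_nonneg (√(p y) - √(q y)), Real.sq_sqrt (hp.1 y), Real.sq_sqrt (hq.1 y)]
  rw [Finset.sum_add_distrib, ← Finset.sum_div, ← Finset.sum_div, hp.2, hq.2] at this
  have h0 : 0 ≤ ∑ y, √(p y) * √(q y) := Finset.sum_nonneg fun y _ => by positivity
  have := Real.log_nonpos h0 (by linarith)
  rw [bhattacharyya]; linarith

/-- With g = √(pq)/Z the normalized geometric mean, D(r‖p) + D(r‖q) = 2 D(r‖g) - 2 log Z, and D(r‖g)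
≥ 0. The proof runs this termwise through log x ≤ x - 1. -/
theorem two_mul_bhattacharyya_le {p q r : Y → ℝ} (hr : r ∈ stdSimplex ℝ Y)
    (hq : q ∈ stdSimplex ℝ Y) (hp0 : ∀ y, 0 < p y) (h : ∀ y, q y = 0 → r y = 0) :
    2 * bhattacharyya p q ≤ relEntropy r p + relEntropy r q := by
  have hZ := sum_sqrt_mul_sqrt_pos hp0 hq
  rw [bhattacharyya]
  set Z := ∑ y, √(p y) * √(q y) with hZdef
  have key : ∀ y, r y * (-2 * Real.log Z) + (2 * r y - 2 * (√(p y) * √(q y) / Z)) ≤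
      r y * Real.log (r y / p y) + r y * Real.log (r y / q y) := by
    intro y
    rcases (hr.1 y).eq_or_lt with h0 | h0
    · rw [← h0]
      have : 0 ≤ √(p y) * √(q y) / Z := by positivity
      simp only [zero_mul, mul_zero]; linarith
    · have hq0 : 0 < q y := lt_of_le_of_ne (hq.1 y) fun e => h0.ne' (h y e.symm)
      have hs : 0 < √(p y) := Real.sqrt_pos.2 (hp0 y)
      have ht : 0 < √(q y) := Real.sqrt_pos.2 hq0
      have h1 := Real.log_le_sub_one_of_pos
        (div_pos (mul_pos hs ht) (mul_pos h0 hZ))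
      rw [Real.log_div (mul_pos hs ht).ne' (mul_pos h0 hZ).ne', Real.log_mul hs.ne' ht.ne',
        Real.log_mul h0.ne' hZ.ne', Real.log_sqrt hq0.le, Real.log_sqrt (hp0 y).le] at h1
      rw [Real.log_div h0.ne' hq0.ne', Real.log_div h0.ne' (hp0 y).ne']
      have h2 : r y * (√(p y) * √(q y) / (r y * Z)) = √(p y) * √(q y) / Z := by
        field_simp
      nlinarith [mul_le_mul_of_nonneg_left h1 h0.le]
  have := Finset.sum_le_sum fun y (_ : y ∈ Finset.univ) => key y
  rw [Finset.sum_add_distrib, Finset.sum_sub_distrib, Finset.sum_add_distrib, ← Finset.sum_mul,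
    ← Finset.mul_sum, ← Finset.mul_sum, ← Finset.sum_div, ← hZdef, hr.2, div_self hZ.ne'] at this
  simp only [relEntropy]
  linarith

/-- The normalized geometric mean of two distributions attains the Bhattacharyya bound. -/
theorem exists_relEntropy_add_eq {p q : Y → ℝ} (hp0 : ∀ y, 0 < p y) (hq : q ∈ stdSimplex ℝ Y)
    (hq0 : ∀ y, 0 < q y) : ∃ r ∈ stdSimplex ℝ Y,
      relEntropy r p + relEntropy r q = 2 * bhattacharyya p q := by
  have hZ := sum_sqrt_mul_sqrt_pos hp0 hq
  rw [bhattacharyya]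
  set Z := ∑ y, √(p y) * √(q y) with hZdef
  have hr : ∑ y, √(p y) * √(q y) / Z = 1 := by
    rw [← Finset.sum_div, ← hZdef, div_self hZ.ne']
  refine ⟨fun y => √(p y) * √(q y) / Z, ⟨fun y => by positivity, hr⟩, ?_⟩
  rw [relEntropy, relEntropy, ← Finset.sum_add_distrib]
  have key : ∀ y, √(p y) * √(q y) / Z * Real.log (√(p y) * √(q y) / Z / p y) +
      √(p y) * √(q y) / Z * Real.log (√(p y) * √(q y) / Z / q y) =
      √(p y) * √(q y) / Z * (2 * -Real.log Z) := by
    intro y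
    have hs : 0 < √(p y) := Real.sqrt_pos.2 (hp0 y)
    have ht : 0 < √(q y) := Real.sqrt_pos.2 (hq0 y)
    have hr0 := div_pos (mul_pos hs ht) hZ
    rw [Real.log_div hr0.ne' (hp0 y).ne', Real.log_div hr0.ne' (hq0 y).ne',
      Real.log_div (mul_pos hs ht).ne' hZ.ne', Real.log_mul hs.ne' ht.ne',
      Real.log_sqrt (hq0 y).le, Real.log_sqrt (hp0 y).le]
    ring
  rw [Finset.sum_congr rfl fun y _ => key y, ← Finset.sum_mul, hr, one_mul]

theorem continuous_relEntropy_left {q : Y → ℝ} (hq0 : ∀ y, 0 < q y) :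
    Continuous fun p : Y → ℝ => relEntropy p q := by
  have : (fun p : Y → ℝ => relEntropy p q) =
      fun p => ∑ y, (-Real.negMulLog (p y) - p y * Real.log (q y)) :=
    funext fun p => relEntropy_eq fun y hy => absurd hy (hq0 y).ne'
  rw [this]
  have := Real.continuous_negMulLog
  fun_prop

theorem continuousOn_bhattacharyya {p : Y → ℝ} (hp0 : ∀ y, 0 < p y) :
    ContinuousOn (fun q : Y → ℝ => bhattacharyya p q) (stdSimplex ℝ Y) := by
  unfold bhattacharyya
  refine ContinuousOn.neg (ContinuousOn.log ?_ fun q hq => (sum_sqrt_mul_sqrt_pos hp0 hq).ne')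
  fun_prop

/-! ### Averages of distributions and the compensation identity. -/

section Average

variable {M : ℕ}

/-- The average of all distributions but the `i`-th one. -/
noncomputable def meanExcept (q : Fin M → Y → ℝ) (i : Fin M) (a : Y) : ℝ :=
  (∑ k ∈ Finset.univ.erase i, q k a) / ((M : ℝ) - 1)

/-- The statistic `U_i` as a function of the distributions of the coordinates. -/
noncomputable def divergenceStat (q : Fin M → Y → ℝ) (i : Fin M) : ℝ :=
  ∑ j ∈ Finset.univ.erase i, relEntropy (q j) (meanExcept q i)

theorem card_erase_cast (i : Fin M) : ((Finset.univ.erase i).card : ℝ) = (M : ℝ) - 1 := by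
  rw [Finset.card_erase_of_mem (Finset.mem_univ i), Finset.card_univ, Fintype.card_fin,
    Nat.cast_sub (by have := i.2; omega)]
  simp

theorem eq_zero_of_meanExcept_eq_zero (hM : 2 ≤ M) {q : Fin M → Y → ℝ}
    (hq : ∀ j, q j ∈ stdSimplex ℝ Y) {i j : Fin M} (hij : j ≠ i) {y : Y}
    (h : meanExcept q i y = 0) : q j y = 0 := by
  have hM' : (2 : ℝ) ≤ M := by exact_mod_cast hM
  rw [meanExcept, div_eq_zero_iff] at h
  rcases h with h | h
  · exact (Finset.sum_eq_zero_iff_of_nonneg fun k _ => (hq k).1 y).1 h j (by simp [hij])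
  · linarith

theorem meanExcept_mem (hM : 2 ≤ M) {q : Fin M → Y → ℝ} (hq : ∀ j, q j ∈ stdSimplex ℝ Y)
    (i : Fin M) : meanExcept q i ∈ stdSimplex ℝ Y := by
  have hM' : (2 : ℝ) ≤ M := by exact_mod_cast hM
  refine ⟨fun y => div_nonneg (Finset.sum_nonneg fun k _ => (hq k).1 y) (by linarith), ?_⟩
  simp only [meanExcept]
  rw [← Finset.sum_div, Finset.sum_comm, Finset.sum_congr rfl fun k _ => (hq k).2,
    Finset.sum_const, nsmul_eq_mul, card_erase_cast, mul_one, div_self (by linarith)]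

theorem divergenceStat_nonneg (hM : 2 ≤ M) {q : Fin M → Y → ℝ} (hq : ∀ j, q j ∈ stdSimplex ℝ Y)
    (i : Fin M) : 0 ≤ divergenceStat q i :=
  Finset.sum_nonneg fun _ hj => relEntropy_nonneg (hq _) (meanExcept_mem hM hq i)
    fun _ => eq_zero_of_meanExcept_eq_zero hM hq (Finset.ne_of_mem_erase hj)

/-- The compensation identity. -/
theorem sum_relEntropy_eq (hM : 2 ≤ M) {q : Fin M → Y → ℝ} (hq : ∀ j, q j ∈ stdSimplex ℝ Y)
    {p : Y → ℝ} (hp0 : ∀ y, 0 < p y) (i : Fin M) :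
    ∑ j ∈ Finset.univ.erase i, relEntropy (q j) p =
      divergenceStat q i + ((M : ℝ) - 1) * relEntropy (meanExcept q i) p := by
  have hM' : (2 : ℝ) ≤ M := by exact_mod_cast hM
  have hp0' : ∀ (r : Y → ℝ) y, p y = 0 → r y = 0 := fun r y hy => absurd hy (hp0 y).ne'
  have h1 : divergenceStat q i = ∑ j ∈ Finset.univ.erase i,
      ∑ y, (-Real.negMulLog (q j y) - q j y * Real.log (meanExcept q i y)) :=
    Finset.sum_congr rfl fun j hj => relEntropy_eq fun _ =>
      eq_zero_of_meanExcept_eq_zero hM hq (Finset.ne_of_mem_erase hj)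
  rw [h1, Finset.sum_congr rfl fun j _ => relEntropy_eq (hp0' (q j)), relEntropy_eq (hp0' _),
    Finset.sum_comm, Finset.sum_comm (s := Finset.univ.erase i), Finset.mul_sum,
    ← Finset.sum_add_distrib]
  refine Finset.sum_congr rfl fun y _ => ?_
  have h2 : ∑ k ∈ Finset.univ.erase i, q k y = ((M : ℝ) - 1) * meanExcept q i y := by
    rw [meanExcept, mul_div_cancel₀ _ (by linarith)]
  rw [Finset.sum_sub_distrib, Finset.sum_sub_distrib, ← Finset.sum_mul, ← Finset.sum_mul, h2,
    Real.negMulLog]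
  ring

/-- The mean is the best common reference distribution. This bound and the next each drop one
nonnegative term of the compensation identity. -/
theorem divergenceStat_le (hM : 2 ≤ M) {q : Fin M → Y → ℝ} (hq : ∀ j, q j ∈ stdSimplex ℝ Y)
    {p : Y → ℝ} (hp : p ∈ stdSimplex ℝ Y) (hp0 : ∀ y, 0 < p y) (i : Fin M) :
    divergenceStat q i ≤ ∑ j ∈ Finset.univ.erase i, relEntropy (q j) p := by
  have hM' : (2 : ℝ) ≤ M := by exact_mod_cast hM
  rw [sum_relEntropy_eq hM hq hp0]
  have := mul_nonneg (by linarith : (0 : ℝ) ≤ (M : ℝ) - 1)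
    (relEntropy_nonneg (meanExcept_mem hM hq i) hp fun y hy => absurd hy (hp0 y).ne')
  linarith

theorem relEntropy_meanExcept_le (hM : 2 ≤ M) {q : Fin M → Y → ℝ}
    (hq : ∀ j, q j ∈ stdSimplex ℝ Y) {p : Y → ℝ} (hp0 : ∀ y, 0 < p y) (i : Fin M) :
    relEntropy (meanExcept q i) p ≤
      1 / ((M : ℝ) - 1) * ∑ j ∈ Finset.univ.erase i, relEntropy (q j) p := by
  have hM' : (2 : ℝ) ≤ M := by exact_mod_cast hM
  have hm : (0 : ℝ) < (M : ℝ) - 1 := by linarith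
  rw [one_div, inv_mul_eq_div, le_div_iff₀ hm, sum_relEntropy_eq hM hq hp0]
  linarith [divergenceStat_nonneg hM hq i]

end Average

end OutlierTest

/-! ### Entropy form of U_k - U_i and the perturbation of ties. -/

namespace OutlierTest

theorem deriv_negMulLog_add_sub {t x : ℝ} (ht : 0 ≤ t) (hx : 0 < x) :
    deriv (fun x => Real.negMulLog (x + t) - Real.negMulLog x) x =
      Real.log x - Real.log (x + t) := by
  have h1 : HasDerivAt (fun x => Real.negMulLog (x + t)) (-Real.log (x + t) - 1) x :=
    (Real.hasDerivAt_negMulLog (by positivity)).comp_add_const x t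
  have h2 := Real.hasDerivAt_negMulLog hx.ne'
  rw [(h1.fun_sub h2).deriv]; ring

/-- The derivative log (x / (x + t)) is strictly increasing exactly because t > 0. -/
theorem strictConvexOn_negMulLog_add_sub {t : ℝ} (ht : 0 < t) :
    StrictConvexOn ℝ (Set.Ici 0) fun x => Real.negMulLog (x + t) - Real.negMulLog x := by
  have hc := Real.continuous_negMulLog
  refine StrictMonoOn.strictConvexOn_of_deriv (convex_Ici 0) (by fun_prop) ?_
  rw [interior_Ici]
  intro x hx y hy hxy
  simp only [Set.mem_Ioi] at hx hy
  rw [deriv_negMulLog_add_sub ht.le hx, deriv_negMulLog_add_sub ht.le hy, ← Real.log_div,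
    ← Real.log_div]
  · apply Real.log_lt_log (by positivity)
    rw [div_lt_div_iff₀ (by positivity) (by positivity)]
    nlinarith
  all_goals positivity

theorem convexOn_negMulLog_add_sub {t : ℝ} (ht : 0 ≤ t) :
    ConvexOn ℝ (Set.Ici 0) fun x => Real.negMulLog (x + t) - Real.negMulLog x := by
  rcases ht.eq_or_lt with rfl | ht
  · simpa using convexOn_const (0 : ℝ) (convex_Ici (0 : ℝ))
  · exact (strictConvexOn_negMulLog_add_sub ht).convexOn

variable {Y : Type*} {M : ℕ}

/-- The total mass of all coordinates but two. -/
noncomputable def restSum (q : Fin M → Y → ℝ) (i k : Fin M) (y : Y) : ℝ :=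
  ∑ j ∈ (Finset.univ.erase i).erase k, q j y

theorem restSum_comm (q : Fin M → Y → ℝ) (i k : Fin M) : restSum q i k = restSum q k i := by
  funext y; rw [restSum, restSum, Finset.erase_right_comm]

theorem sum_erase_eq (q : Fin M → Y → ℝ) {i k : Fin M} (h : i ≠ k) (y : Y) :
    ∑ j ∈ Finset.univ.erase i, q j y = q k y + restSum q i k y :=
  (Finset.add_sum_erase _ (fun j => q j y) (by simp [h.symm])).symm

variable [Fintype Y]

/-- The entropy gained by adding the masses `T` to the masses `x`, up to a constant. -/
noncomputable def entropyGain (T x : Y → ℝ) : ℝ :=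
  ∑ y, (Real.negMulLog (x y + T y) - Real.negMulLog (x y))

theorem convexOn_entropyGain {T : Y → ℝ} (hT : ∀ y, 0 ≤ T y) :
    ConvexOn ℝ (stdSimplex ℝ Y) (entropyGain T) := by
  refine ⟨convex_stdSimplex ℝ Y, fun x hx z hz a b ha hb hab => ?_⟩
  simp only [entropyGain, smul_eq_mul, Finset.mul_sum]
  rw [← Finset.sum_add_distrib]
  exact Finset.sum_le_sum fun y _ =>
    (convexOn_negMulLog_add_sub (hT y)).2 (hx.1 y) (hz.1 y) ha hb hab

theorem entropyGain_lt {T : Y → ℝ} (hT : ∀ y, 0 ≤ T y) {x z : Y → ℝ} (hx : x ∈ stdSimplex ℝ Y)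
    (hz : z ∈ stdSimplex ℝ Y) {a b : ℝ} (ha : 0 < a) (hb : 0 < b) (hab : a + b = 1) {y : Y}
    (hTy : 0 < T y) (hxz : x y ≠ z y) :
    entropyGain T (a • x + b • z) < a * entropyGain T x + b * entropyGain T z := by
  simp only [entropyGain, Finset.mul_sum]
  rw [← Finset.sum_add_distrib]
  exact Finset.sum_lt_sum (fun w _ =>
    (convexOn_negMulLog_add_sub (hT w)).2 (hx.1 w) (hz.1 w) ha.le hb.le hab) ⟨y, Finset.mem_univ y,
    (strictConvexOn_negMulLog_add_sub hTy).2 (hx.1 y) (hz.1 y) hxz ha hb hab⟩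

theorem exists_mem_stdSimplex_ne [Nontrivial Y] (x : Y → ℝ) (y : Y) :
    ∃ w ∈ stdSimplex ℝ Y, w y ≠ x y := by
  classical
  obtain ⟨z, hz⟩ := exists_ne y
  by_cases h : x y = 1
  · exact ⟨_, single_mem_stdSimplex ℝ z, by rw [h, Pi.single_eq_of_ne hz.symm]; norm_num⟩
  · exact ⟨_, single_mem_stdSimplex ℝ y, by rw [Pi.single_eq_same]; exact Ne.symm h⟩

/-- A weak inequality between values of `entropyGain T` becomes strict along suitable segments. -/
theorem exists_segment_entropyGain_lt [Nontrivial Y] {T : Y → ℝ} (hT : ∀ y, 0 ≤ T y)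
    (hT0 : ∃ y, 0 < T y) {x z : Y → ℝ} (hx : x ∈ stdSimplex ℝ Y) (hz : z ∈ stdSimplex ℝ Y)
    (hxz : entropyGain T x ≤ entropyGain T z) :
    ∃ x' ∈ stdSimplex ℝ Y, ∃ z' ∈ stdSimplex ℝ Y, ∀ t : ℝ, 0 < t → t < 1 →
      entropyGain T ((1 - t) • x + t • x') < entropyGain T ((1 - t) • z + t • z') := by
  have self : ∀ (u : Y → ℝ) (t : ℝ), (1 - t) • u + t • u = u := fun u t => by
    rw [← add_smul]; simp
  -- If x is not a minimizer, moving it towards a lower point makes the inequality strict by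
  -- convexity.
  by_cases h : ∃ w ∈ stdSimplex ℝ Y, entropyGain T w < entropyGain T x
  · obtain ⟨w, hw, hwx⟩ := h
    refine ⟨w, hw, z, hz, fun t ht ht1 => ?_⟩
    rw [self]
    have := (convexOn_entropyGain hT).2 hx hw (by linarith : 0 ≤ 1 - t) ht.le (by ring)
    simp only [smul_eq_mul] at this
    nlinarith
  push Not at h
  rcases hxz.lt_or_eq with hlt | heq
  · exact ⟨x, hx, z, hz, fun t _ _ => by rwa [self, self]⟩
  -- Here x and z are both minimizers, so z is moved instead: if the new point u were no higher,
  -- strict convexity in the letter y would put the midpoint of z and u below the minimum.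
  obtain ⟨y, hy⟩ := hT0
  obtain ⟨w, hw, hwz⟩ := exists_mem_stdSimplex_ne z y
  refine ⟨x, hx, w, hw, fun t ht ht1 => ?_⟩
  rw [self]
  set u := (1 - t) • z + t • w with hu
  have hus : u ∈ stdSimplex ℝ Y := convex_stdSimplex ℝ Y hz hw (by linarith) ht.le (by ring)
  have hne : z y ≠ u y := by
    intro e
    have : t * (w y - z y) = 0 := by
      simp only [hu, Pi.add_apply, Pi.smul_apply, smul_eq_mul] at e; linarith
    rcases mul_eq_zero.1 this with h' | h'
    · exact ht.ne' h'
    · exact hwz (by linarith)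
  have h1 := entropyGain_lt hT hz hus (a := 1 / 2) (b := 1 / 2) (by norm_num) (by norm_num)
    (by norm_num) hy hne
  have h2 := h _ (convex_stdSimplex ℝ Y hz hus (a := 1 / 2) (b := 1 / 2) (by norm_num)
    (by norm_num) (by norm_num))
  linarith

/-- The last bracket does not depend on i, and the rest sum is symmetric in i and k, so almost
everything cancels in U_k - U_i. -/
theorem divergenceStat_eq (hM : 2 ≤ M) {q : Fin M → Y → ℝ} (hq : ∀ j, q j ∈ stdSimplex ℝ Y)
    {i k : Fin M} (h : i ≠ k) :
    divergenceStat q i = ∑ y, (Real.negMulLog (q k y + restSum q i k y) + Real.negMulLog (q i y)) +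
      (((M : ℝ) - 1) * Real.log ((M : ℝ) - 1) - ∑ j, ∑ y, Real.negMulLog (q j y)) := by
  have hM' : (2 : ℝ) ≤ M := by exact_mod_cast hM
  set m : ℝ := (M : ℝ) - 1 with hm
  have hm0 : 0 < m := by linarith
  have h1 : divergenceStat q i = ∑ j ∈ Finset.univ.erase i,
      ∑ y, (-Real.negMulLog (q j y) - q j y * Real.log (meanExcept q i y)) :=
    Finset.sum_congr rfl fun j hj => relEntropy_eq fun _ =>
      eq_zero_of_meanExcept_eq_zero hM hq (Finset.ne_of_mem_erase hj)
  have h2 : ∀ y, ∑ j ∈ Finset.univ.erase i, q j y * Real.log (meanExcept q i y) =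
      -Real.negMulLog (q k y + restSum q i k y) -
        (∑ j ∈ Finset.univ.erase i, q j y) * Real.log m := by
    intro y
    rw [← Finset.sum_mul, meanExcept, ← hm]
    rw [mul_log_div_eq fun h0 => absurd h0 hm0.ne', sum_erase_eq q h]
  have h3 : ∑ y, ∑ j ∈ Finset.univ.erase i, q j y = m := by
    rw [Finset.sum_comm, Finset.sum_congr rfl fun k _ => (hq k).2, Finset.sum_const, nsmul_eq_mul,
      card_erase_cast, mul_one]
  have h4 := Finset.add_sum_erase Finset.univ (fun j => ∑ y, Real.negMulLog (q j y))
    (Finset.mem_univ i)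
  rw [h1]
  simp only [Finset.sum_sub_distrib, Finset.sum_neg_distrib, Finset.sum_add_distrib]
  rw [Finset.sum_comm (f := fun j y => q j y * Real.log (meanExcept q i y)),
    Finset.sum_congr rfl fun y _ => h2 y, Finset.sum_sub_distrib, ← Finset.sum_mul, h3,
    Finset.sum_neg_distrib, ← h4]
  ring

theorem divergenceStat_sub (hM : 2 ≤ M) {q : Fin M → Y → ℝ} (hq : ∀ j, q j ∈ stdSimplex ℝ Y)
    {i k : Fin M} (h : i ≠ k) :
    divergenceStat q k - divergenceStat q i =
      entropyGain (restSum q i k) (q i) - entropyGain (restSum q i k) (q k) := by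
  rw [divergenceStat_eq hM hq h, divergenceStat_eq hM hq h.symm, restSum_comm q k i]
  simp only [entropyGain, Finset.sum_sub_distrib, Finset.sum_add_distrib]
  ring

/-- A continuous version of `U_k - U_i`. -/
noncomputable def statGap (i k : Fin M) (q : Fin M → Y → ℝ) : ℝ :=
  entropyGain (restSum q i k) (q i) - entropyGain (restSum q i k) (q k)

theorem continuous_statGap (i k : Fin M) : Continuous (statGap (Y := Y) i k) := by
  unfold statGap entropyGain restSum
  have := Real.continuous_negMulLog
  fun_prop

theorem statGap_self_of_eq {i k : Fin M} {q : Fin M → Y → ℝ} (h : q i = q k) :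
    statGap i k q = 0 := by
  rw [statGap, h, sub_self]

/-- Only coordinates i and k move, so the rest sum stays fixed and the segment lemma applies. With M
= 2 the rest sum is zero and the gap vanishes identically. -/
theorem exists_path_statGap_neg [Nontrivial Y] (hM : 3 ≤ M) {q : Fin M → Y → ℝ}
    (hq : ∀ j, q j ∈ stdSimplex ℝ Y) {i k : Fin M} (h : i ≠ k) (hgap : statGap i k q ≤ 0) :
    ∃ c : ℝ → Fin M → Y → ℝ, Continuous c ∧ c 0 = q ∧ ∀ t, 0 < t → t < 1 →
      (∀ j, c t j ∈ stdSimplex ℝ Y) ∧ statGap i k (c t) < 0 := by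
  classical
  have hT : ∀ y, 0 ≤ restSum q i k y := fun y => Finset.sum_nonneg fun j _ => (hq j).1 y
  have hT0 : ∃ y, 0 < restSum q i k y := by
    by_contra! hcon
    have hcard : 0 < ((Finset.univ.erase i).erase k).card := by
      rw [Finset.card_erase_of_mem (by simp [h.symm]), Finset.card_erase_of_mem (Finset.mem_univ i),
        Finset.card_univ, Fintype.card_fin]
      omega
    obtain ⟨j, hj⟩ := Finset.card_pos.1 hcard
    have : ∑ y, q j y ≤ ∑ y : Y, (0 : ℝ) := Finset.sum_le_sum fun y _ =>
      (Finset.single_le_sum (fun l _ => (hq l).1 y) hj).trans (hcon y)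
    rw [(hq j).2] at this
    norm_num at this
  obtain ⟨x', hx', z', hz', hlt⟩ := exists_segment_entropyGain_lt hT hT0 (hq i) (hq k)
    (by unfold statGap at hgap; linarith)
  refine ⟨fun t => Function.update (Function.update q i ((1 - t) • q i + t • x')) k
    ((1 - t) • q k + t • z'), ?_, by simp, fun t ht ht1 => ⟨fun j => ?_, ?_⟩⟩
  · exact (continuous_const.update i (by fun_prop)).update k (by fun_prop)
  · beta_reduce
    by_cases hjk : j = k
    · subst hjk
      rw [Function.update_self]
      exact convex_stdSimplex ℝ Y (hq _) hz' (by linarith) ht.le (by ring)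
    rw [Function.update_of_ne hjk]
    by_cases hji : j = i
    · subst hji
      rw [Function.update_self]
      exact convex_stdSimplex ℝ Y (hq _) hx' (by linarith) ht.le (by ring)
    rw [Function.update_of_ne hji]
    exact hq j
  · have hrest : restSum (Function.update (Function.update q i ((1 - t) • q i + t • x')) k
        ((1 - t) • q k + t • z')) i k = restSum q i k := by
      funext y
      refine Finset.sum_congr rfl fun j hj => ?_
      simp only [Finset.mem_erase, Finset.mem_univ, and_true] at hj
      rw [Function.update_of_ne hj.1, Function.update_of_ne hj.2]
    beta_reduce
    rw [statGap, hrest, Function.update_self, Function.update_of_ne h, Function.update_self]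
    linarith [hlt t ht ht1]

end OutlierTest

/-! ### Product laws: Chebyshev's inequality, change of measure and the method of types. -/

namespace OutlierTest

variable {Y : Type*} {M n : ℕ}

/-- The joint probability mass function of independent coordinates with distributions `p j`. -/
noncomputable def productPmf (p : Fin M → Y → ℝ) (y : Fin M → Fin n → Y) : ℝ :=
  ∏ j, ∏ k, p j (y j k)

/-- The distributions of the coordinates under a hypothesis. -/
def coordLaw (μ π : Y → ℝ) (h : Option (Fin M)) (j : Fin M) : Y → ℝ :=
  if h = some j then μ else π

theorem jointPmf_eq (μ π : Y → ℝ) (h : Option (Fin M)) :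
    jointPmf (n := n) μ π h = productPmf (coordLaw μ π h) := by
  funext y
  rw [jointPmf, productPmf, Finset.prod_comm]
  refine Finset.prod_congr rfl fun j _ => Finset.prod_congr rfl fun k _ => ?_
  rw [coordLaw]; split_ifs <;> rfl

theorem productPmf_nonneg {p : Fin M → Y → ℝ} (hp : ∀ j a, 0 ≤ p j a) (y : Fin M → Fin n → Y) :
    0 ≤ productPmf p y :=
  Finset.prod_nonneg fun j _ => Finset.prod_nonneg fun k _ => hp j (y j k)

theorem coordLaw_pos {μ π : Y → ℝ} (hμ : ∀ y, 0 < μ y) (hπ : ∀ y, 0 < π y)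
    (h : Option (Fin M)) (j : Fin M) (a : Y) : 0 < coordLaw μ π h j a := by
  rw [coordLaw]; split_ifs <;> [exact hμ a; exact hπ a]

theorem empirical_pos [DecidableEq Y] (s : Fin n → Y) (k : Fin n) : 0 < empirical s (s k) := by
  have hn : (0 : ℝ) < n := by exact_mod_cast k.pos
  refine div_pos ?_ hn
  exact_mod_cast Finset.card_pos.2 ⟨k, by simp⟩

variable [Fintype Y]

theorem sum_prod_prod (f : Fin M → Fin n → Y → ℝ) :
    ∑ y : Fin M → Fin n → Y, ∏ j, ∏ k, f j k (y j k) = ∏ j, ∏ k, ∑ a, f j k a := by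
  classical
  simp only [Fintype.prod_sum]

theorem sum_productPmf {p : Fin M → Y → ℝ} (hp : ∀ j, ∑ a, p j a = 1) :
    ∑ y : Fin M → Fin n → Y, productPmf p y = 1 := by
  simp only [productPmf]
  rw [sum_prod_prod fun j _ a => p j a]
  simp [hp]

theorem sum_productPmf_mul_mul (p : Fin M → Y → ℝ) {g : Y → ℝ} {j : Fin M}
    (hg : ∑ a, p j a * g a = 0) {k l : Fin n} (hkl : k ≠ l) :
    ∑ y : Fin M → Fin n → Y, productPmf p y * (g (y j k) * g (y j l)) = 0 := by
  -- The indicators spread the two factors over all indices, so that the sum factorizes; the factor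
  -- at (j, k) is the mean of g, which is zero.
  have h1 : ∀ y : Fin M → Fin n → Y, productPmf p y * (g (y j k) * g (y j l)) =
      ∏ j', ∏ k', (p j' (y j' k') * ((if j' = j then if k' = k then g (y j' k') else 1 else 1) *
        (if j' = j then if k' = l then g (y j' k') else 1 else 1))) := by
    intro y
    simp only [Finset.prod_mul_distrib, productPmf]
    congr 2
    · rw [Finset.prod_eq_single j (fun j' _ h => by simp [h]) (by simp)]
      simp
    · rw [Finset.prod_eq_single j (fun j' _ h => by simp [h]) (by simp)]
      simp
  rw [Finset.sum_congr rfl fun y _ => h1 y,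
    sum_prod_prod fun j' k' a => p j' a * ((if j' = j then if k' = k then g a else 1 else 1) *
        (if j' = j then if k' = l then g a else 1 else 1))]
  refine Finset.prod_eq_zero (Finset.mem_univ j) (Finset.prod_eq_zero (Finset.mem_univ k) ?_)
  simpa [hkl] using hg

variable [DecidableEq Y]

theorem cast_mul_sum_empirical (s : Fin n → Y) (f : Y → ℝ) :
    (n : ℝ) * ∑ a, empirical s a * f a = ∑ k, f (s k) := by
  rcases Nat.eq_zero_or_pos n with rfl | hn
  · simp
  have hn' : (n : ℝ) ≠ 0 := by positivity
  rw [← Finset.sum_fiberwise Finset.univ s, Finset.mul_sum]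
  refine Finset.sum_congr rfl fun a _ => ?_
  rw [Finset.sum_congr rfl (g := fun _ => f a) (by simp +contextual), Finset.sum_const,
    nsmul_eq_mul, empirical]
  field_simp

theorem empirical_mem (hn : n ≠ 0) (s : Fin n → Y) : empirical s ∈ stdSimplex ℝ Y := by
  refine ⟨fun a => by rw [empirical]; positivity, ?_⟩
  have := cast_mul_sum_empirical s fun _ => 1
  simp only [mul_one, Finset.sum_const, Finset.card_univ, Fintype.card_fin, nsmul_eq_mul] at this
  exact mul_left_cancel₀ (Nat.cast_ne_zero.2 hn) (by rw [this, mul_one])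

/-- The variance of an empirical frequency is at most `1 / n`. -/
theorem sum_productPmf_mul_sq_le (hn : n ≠ 0) {p : Fin M → Y → ℝ}
    (hp : ∀ j, p j ∈ stdSimplex ℝ Y) (j : Fin M) (a : Y) :
    ∑ y : Fin M → Fin n → Y, productPmf p y * (empirical (y j) a - p j a) ^ 2 ≤ 1 / n := by
  have hn' : (0 : ℝ) < n := by positivity
  set g : Y → ℝ := fun b => (if b = a then 1 else 0) - p j a with hg
  have hg0 : ∑ b, p j b * g b = 0 := by
    simp only [hg, mul_sub, Finset.sum_sub_distrib, ← Finset.sum_mul, (hp j).2]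
    simp
  have hpa : p j a ≤ 1 := (hp j).2 ▸ Finset.single_le_sum (fun z _ => (hp j).1 z)
    (Finset.mem_univ a)
  have hg1 : ∀ b, g b * g b ≤ 1 := by
    intro b
    have := (hp j).1 a
    simp only [hg]; split_ifs <;> nlinarith
  have hemp : ∀ y : Fin M → Fin n → Y, empirical (y j) a - p j a = (∑ k, g (y j k)) / n := by
    intro y
    rw [eq_div_iff hn'.ne', ← cast_mul_sum_empirical]
    simp only [hg, mul_sub, Finset.sum_sub_distrib, ← Finset.sum_mul, (empirical_mem hn (y j)).2]
    simp; ring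
  have hsq : ∀ y : Fin M → Fin n → Y, productPmf p y * (empirical (y j) a - p j a) ^ 2 =
      (∑ k, ∑ l, productPmf p y * (g (y j k) * g (y j l))) / (n : ℝ) ^ 2 := by
    intro y
    simp only [← Finset.mul_sum, ← Finset.sum_mul]
    rw [hemp]; ring
  rw [Finset.sum_congr rfl fun y _ => hsq y, ← Finset.sum_div, Finset.sum_comm]
  have hle : ∀ k : Fin n, ∑ y : Fin M → Fin n → Y,
      ∑ l, productPmf p y * (g (y j k) * g (y j l)) ≤ 1 := by
    intro k
    -- Distinct observations are uncorrelated, so only the diagonal l = k survives.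
    rw [Finset.sum_comm, Finset.sum_eq_single k
      (fun l _ hl => sum_productPmf_mul_mul p hg0 hl.symm) (by simp)]
    rw [← sum_productPmf (n := n) fun j => (hp j).2]
    exact Finset.sum_le_sum fun y _ =>
      mul_le_of_le_one_right (productPmf_nonneg (fun j => (hp j).1) y) (hg1 _)
  have hle2 := Finset.sum_le_sum fun k (_ : k ∈ Finset.univ) => hle k
  simp only [Finset.sum_const, Finset.card_univ, Fintype.card_fin, nsmul_eq_mul, mul_one] at hle2
  rw [div_le_div_iff₀ (by positivity) hn']
  nlinarith

/-- Chebyshev's inequality and a union bound over the M · |Y| frequencies. -/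
theorem one_sub_le_sum_productPmf (hn : n ≠ 0) {p : Fin M → Y → ℝ}
    (hp : ∀ j, p j ∈ stdSimplex ℝ Y) {ε : ℝ} (hε : 0 < ε) :
    1 - M * Fintype.card Y / (n * ε ^ 2) ≤ ∑ y : Fin M → Fin n → Y with
      ∀ j a, |empirical (y j) a - p j a| < ε, productPmf p y := by
  have h0 := productPmf_nonneg (n := n) fun j => (hp j).1
  have h1 : ∀ y : Fin M → Fin n → Y, productPmf p y ≤
      (if ∀ j a, |empirical (y j) a - p j a| < ε then productPmf p y else 0) +
        (∑ j, ∑ a, productPmf p y * (empirical (y j) a - p j a) ^ 2) / ε ^ 2 := by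
    intro y
    have hnn : ∀ j a, 0 ≤ productPmf p y * (empirical (y j) a - p j a) ^ 2 :=
      fun j a => mul_nonneg (h0 y) (sq_nonneg _)
    split_ifs with h
    · exact le_add_of_nonneg_right (div_nonneg
        (Finset.sum_nonneg fun j _ => Finset.sum_nonneg fun a _ => hnn j a) (by positivity))
    · push Not at h
      obtain ⟨j, a, hja⟩ := h
      rw [zero_add, le_div_iff₀ (by positivity)]
      calc productPmf p y * ε ^ 2 ≤ productPmf p y * (empirical (y j) a - p j a) ^ 2 :=
            mul_le_mul_of_nonneg_left (by rw [← sq_abs (_ - _)]; gcongr) (h0 y)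
        _ ≤ ∑ a, productPmf p y * (empirical (y j) a - p j a) ^ 2 :=
            Finset.single_le_sum (fun a _ => hnn j a) (Finset.mem_univ a)
        _ ≤ _ := Finset.single_le_sum (f := fun j => ∑ a, productPmf p y *
            (empirical (y j) a - p j a) ^ 2)
            (fun j _ => Finset.sum_nonneg fun a _ => hnn j a) (Finset.mem_univ j)
  have h2 := Finset.sum_le_sum fun y (_ : y ∈ Finset.univ) => h1 y
  rw [sum_productPmf fun j => (hp j).2, Finset.sum_add_distrib, ← Finset.sum_filter,
    ← Finset.sum_div, Finset.sum_comm] at h2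
  have h3 : ∑ j, ∑ y : Fin M → Fin n → Y,
      ∑ a, productPmf p y * (empirical (y j) a - p j a) ^ 2 ≤ M * Fintype.card Y * (1 / n) := by
    have : ∀ j : Fin M, ∑ y : Fin M → Fin n → Y, ∑ a, productPmf p y *
        (empirical (y j) a - p j a) ^ 2 ≤ Fintype.card Y * (1 / n) := by
      intro j
      rw [Finset.sum_comm]
      refine (Finset.sum_le_sum fun a _ => sum_productPmf_mul_sq_le hn hp j a).trans_eq ?_
      simp
    refine (Finset.sum_le_sum fun j _ => this j).trans_eq ?_
    simp [mul_assoc]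
  have h4 := div_le_div_of_nonneg_right h3 (sq_nonneg ε)
  have h5 : (M : ℝ) * Fintype.card Y * (1 / n) / ε ^ 2 = M * Fintype.card Y / (n * ε ^ 2) := by
    rw [mul_one_div, div_div]
  linarith

/-- The normalized log-likelihood ratio of two product distributions, in terms of types. -/
noncomputable def logRatio (q p γ : Fin M → Y → ℝ) : ℝ :=
  ∑ j, ∑ a, γ j a * Real.log (q j a / p j a)

/-- The total relative entropy of product distributions. -/
noncomputable def totalEntropy (q p : Fin M → Y → ℝ) : ℝ := ∑ j, relEntropy (q j) (p j)

theorem exp_neg_logRatio (q p : Fin M → Y → ℝ) (y : Fin M → Fin n → Y) :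
    Real.exp (-(n * logRatio q p fun j => empirical (y j))) =
      ∏ j, ∏ k, Real.exp (-Real.log (q j (y j k) / p j (y j k))) := by
  rw [logRatio, Finset.mul_sum]
  simp only [cast_mul_sum_empirical, ← Finset.sum_neg_distrib, Real.exp_sum]

theorem mul_exp_neg_log_div {a b : ℝ} (ha : 0 < a) (hb : 0 < b) :
    a * Real.exp (-Real.log (a / b)) = b := by
  rw [Real.exp_neg, Real.exp_log (div_pos ha hb)]; field_simp

/-- Change of measure. Only an inequality holds, since q may vanish at an observed letter. -/
theorem productPmf_mul_exp_le {q p : Fin M → Y → ℝ} (hq : ∀ j a, 0 ≤ q j a)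
    (hp : ∀ j a, 0 < p j a) (y : Fin M → Fin n → Y) :
    productPmf q y * Real.exp (-(n * logRatio q p fun j => empirical (y j))) ≤ productPmf p y := by
  rw [exp_neg_logRatio, productPmf, ← Finset.prod_mul_distrib, productPmf]
  refine Finset.prod_le_prod (fun j _ => mul_nonneg (Finset.prod_nonneg fun k _ => hq _ _)
    (Finset.prod_nonneg fun k _ => (Real.exp_pos _).le)) fun j _ => ?_
  rw [← Finset.prod_mul_distrib]
  refine Finset.prod_le_prod (fun k _ => mul_nonneg (hq _ _) (Real.exp_pos _).le) fun k _ => ?_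
  rcases (hq j (y j k)).eq_or_lt with h | h
  · rw [← h, zero_mul]; exact (hp _ _).le
  · exact (mul_exp_neg_log_div h (hp _ _)).le

/-- Change of measure to the empirical laws of the data themselves; these charge every observed
letter, hence equality. -/
theorem productPmf_eq {p : Fin M → Y → ℝ} (hp : ∀ j a, 0 < p j a) (y : Fin M → Fin n → Y) :
    productPmf p y = productPmf (fun j => empirical (y j)) y *
      Real.exp (-(n * totalEntropy (fun j => empirical (y j)) p)) := by
  have : totalEntropy (fun j => empirical (y j)) p =
    logRatio (fun j => empirical (y j)) p fun j => empirical (y j) := rfl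
  rw [this, exp_neg_logRatio, productPmf, productPmf, ← Finset.prod_mul_distrib]
  refine Finset.prod_congr rfl fun j _ => ?_
  rw [← Finset.prod_mul_distrib]
  exact Finset.prod_congr rfl fun k _ => (mul_exp_neg_log_div (empirical_pos _ _) (hp _ _)).symm

/-- Each term is at most the sum over all possible types, and each fixed type is a law of total mass
1, so the number of count arrays bounds the total. -/
theorem sum_productPmf_empirical_le (hn : n ≠ 0) :
    ∑ y : Fin M → Fin n → Y, productPmf (fun j => empirical (y j)) y ≤
      ((n : ℝ) + 1) ^ (Fintype.card Y * M) := by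
  set S : Finset (Fin M → Y → Fin (n + 1)) :=
    {t | ∀ j, ∑ a, ((t j a : ℕ) : ℝ) / n = 1} with hS
  let W : (Fin M → Fin n → Y) → (Fin M → Y → Fin (n + 1)) → ℝ := fun y t =>
    productPmf (fun j a => ((t j a : ℕ) : ℝ) / n) y
  have h1 : ∀ y : Fin M → Fin n → Y, productPmf (fun j => empirical (y j)) y ≤
      ∑ t ∈ S, W y t := by
    intro y
    set t : Fin M → Y → Fin (n + 1) := fun j a => ⟨Finset.card {k | y j k = a}, by
      have := Finset.card_le_univ {k | y j k = a}
      rw [Fintype.card_fin] at this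
      omega⟩ with ht
    have htS : t ∈ S := by
      simp only [hS, Finset.mem_filter, Finset.mem_univ, true_and]
      exact fun j => (empirical_mem hn (y j)).2
    have e : (fun j => empirical (y j)) = fun j a => ((t j a : ℕ) : ℝ) / n := rfl
    rw [e]
    exact Finset.single_le_sum (f := W y)
      (fun t _ => productPmf_nonneg (fun j a => by positivity) y) htS
  refine (Finset.sum_le_sum fun y _ => h1 y).trans ?_
  rw [Finset.sum_comm, Finset.sum_congr rfl fun t ht => sum_productPmf (by simpa [hS] using ht)]
  rw [Finset.sum_const, nsmul_eq_mul, mul_one]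
  have := Finset.card_le_univ S
  simp only [Fintype.card_pi, Finset.prod_const, Finset.card_univ, Fintype.card_fin, ← pow_mul]
    at this
  exact_mod_cast this

/-- The upper bound of Sanov's theorem. -/
theorem sum_productPmf_le (hn : n ≠ 0) {p : Fin M → Y → ℝ} (hp : ∀ j a, 0 < p j a) {c : ℝ}
    (S : Finset (Fin M → Fin n → Y))
    (hS : ∀ y ∈ S, c ≤ totalEntropy (fun j => empirical (y j)) p) :
    ∑ y ∈ S, productPmf p y ≤ ((n : ℝ) + 1) ^ (Fintype.card Y * M) * Real.exp (-(n * c)) := by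
  have h0 : ∀ y : Fin M → Fin n → Y, 0 ≤ productPmf (fun j => empirical (y j)) y :=
    fun y => productPmf_nonneg (fun j => (empirical_mem hn (y j)).1) y
  calc ∑ y ∈ S, productPmf p y
      ≤ ∑ y ∈ S, productPmf (fun j => empirical (y j)) y * Real.exp (-(n * c)) := by
        refine Finset.sum_le_sum fun y hy => ?_
        rw [productPmf_eq hp]
        refine mul_le_mul_of_nonneg_left (Real.exp_le_exp.2 ?_) (h0 y)
        have := mul_le_mul_of_nonneg_left (hS y hy) (Nat.cast_nonneg (α := ℝ) n)
        linarith
    _ ≤ ∑ y, productPmf (fun j => empirical (y j)) y * Real.exp (-(n * c)) :=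
        Finset.sum_le_sum_of_subset_of_nonneg (Finset.subset_univ _) fun y _ _ =>
          mul_nonneg (h0 y) (Real.exp_pos _).le
    _ ≤ _ := by
        rw [← Finset.sum_mul]
        exact mul_le_mul_of_nonneg_right (sum_productPmf_empirical_le hn) (Real.exp_pos _).le

end OutlierTest

/-! ### Exponents from two-sided bounds, and the variational formula for the exponent. -/

namespace OutlierTest

theorem tendsto_log_div_natCast :
    Tendsto (fun n : ℕ => Real.log n / (n : ℝ)) atTop (𝓝 0) := by
  have := (Real.tendsto_pow_log_div_mul_add_atTop 1 0 1 one_ne_zero).comp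
    (tendsto_natCast_atTop_atTop (R := ℝ))
  simpa [Function.comp_def] using this

theorem tendsto_log_add_one_div_natCast :
    Tendsto (fun n : ℕ => Real.log ((n : ℝ) + 1) / (n : ℝ)) atTop (𝓝 0) := by
  have h : Tendsto (fun n : ℕ => (n : ℝ) + 1) atTop atTop :=
    tendsto_atTop_add_const_right _ _ tendsto_natCast_atTop_atTop
  have := (Real.tendsto_pow_log_div_mul_add_atTop 1 (-1) 1 one_ne_zero).comp h
  simpa [Function.comp_def] using this

theorem hasExponent_of_bounds {e : ℕ → ℝ} {a : ℝ} (D : ℕ)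
    (hlow : ∀ η, 0 < η → ∀ᶠ n : ℕ in atTop, 1 / 2 * Real.exp (-(n * (a + η))) ≤ e n)
    (hup : ∀ η, 0 < η → ∀ᶠ n : ℕ in atTop,
      e n ≤ ((n : ℝ) + 1) ^ D * Real.exp (-(n * (a - η)))) : HasExponent e a := by
  have hpos : ∀ᶠ n in atTop, 0 < e n := (hlow 1 one_pos).mono fun n hn => by
    have := Real.exp_pos (-(n * (a + 1)))
    linarith
  refine ⟨hpos, Metric.tendsto_atTop'.2 fun ε hε => ?_⟩
  have h1 := (tendsto_log_add_one_div_natCast.const_mul (D : ℝ)).eventually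
    (gt_mem_nhds (show (D : ℝ) * 0 < ε / 2 by simpa using half_pos hε))
  have h2 := (tendsto_const_div_atTop_nhds_zero_nat (Real.log 2)).eventually
    (gt_mem_nhds (half_pos hε))
  have h3 := hpos.and ((hlow _ (half_pos hε)).and ((hup _ (half_pos hε)).and
    (h1.and (h2.and (eventually_gt_atTop 0)))))
  obtain ⟨N, hN⟩ := eventually_atTop.1 h3
  refine ⟨N, fun n hn => ?_⟩
  obtain ⟨h0, hl, hu, h1, h2, hn0⟩ := hN n hn.le
  have hn' : (0 : ℝ) < n := by exact_mod_cast hn0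
  have hl' := Real.log_le_log (by positivity) hl
  have hu' := Real.log_le_log h0 hu
  rw [Real.log_mul (by norm_num) (Real.exp_pos _).ne', Real.log_exp, one_div, Real.log_inv] at hl'
  rw [Real.log_mul (by positivity) (Real.exp_pos _).ne', Real.log_exp, Real.log_pow] at hu'
  rw [← mul_div_assoc, div_lt_iff₀ hn'] at h1
  rw [div_lt_iff₀ hn'] at h2
  have e1 : -(1 / (n : ℝ)) * Real.log (e n) = -Real.log (e n) / n := by ring
  rw [Real.dist_eq, e1, abs_lt]
  constructor
  · rw [lt_sub_iff_add_lt, lt_div_iff₀ hn']; nlinarith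
  · rw [sub_lt_iff_lt_add, div_lt_iff₀ hn']; nlinarith

variable {Y : Type*} [Fintype Y] {M : ℕ}

/-- The tuples of types for which the `i`-th statistic is not the unique smallest one. -/
def errorRegion (Y : Type*) [Fintype Y] (i : Fin M) : Set (Fin M → Y → ℝ) :=
  {q | (∀ j, q j ∈ stdSimplex ℝ Y) ∧ ∃ k, i ≠ k ∧ statGap i k q ≤ 0}

/-- The error exponent under the hypothesis that the `i`-th coordinate is the outlier. -/
noncomputable def errorExponent (μ π : Y → ℝ) (i : Fin M) : ℝ :=
  sInf ((fun q => totalEntropy q (coordLaw μ π (some i))) '' errorRegion Y i)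

theorem isCompact_product_simplex : IsCompact {q : Fin M → Y → ℝ | ∀ j, q j ∈ stdSimplex ℝ Y} := by
  have := isCompact_univ_pi fun _ : Fin M => isCompact_stdSimplex ℝ Y
  simpa [Set.pi] using this

theorem isCompact_errorRegion (i : Fin M) : IsCompact (errorRegion Y i) := by
  have : errorRegion Y i = {q : Fin M → Y → ℝ | ∀ j, q j ∈ stdSimplex ℝ Y} ∩
      ⋃ k, {q | i ≠ k ∧ statGap i k q ≤ 0} := by
    ext q; simp [errorRegion]
  rw [this]
  refine isCompact_product_simplex.inter_right (isClosed_iUnion_of_finite fun k => ?_)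
  exact isClosed_const.and (isClosed_le (continuous_statGap i k) continuous_const)

theorem continuous_totalEntropy {p : Fin M → Y → ℝ} (hp : ∀ j a, 0 < p j a) :
    Continuous fun q => totalEntropy q p :=
  continuous_finsetSum _ fun j _ => (continuous_relEntropy_left (hp j)).comp (continuous_apply j)

theorem continuous_logRatio (q p : Fin M → Y → ℝ) : Continuous (logRatio q p) := by
  unfold logRatio; fun_prop

theorem totalEntropy_coordLaw (μ π : Y → ℝ) (i : Fin M) (q : Fin M → Y → ℝ) :
    totalEntropy q (coordLaw μ π (some i)) =
      relEntropy (q i) μ + ∑ j ∈ Finset.univ.erase i, relEntropy (q j) π := by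
  rw [totalEntropy, ← Finset.add_sum_erase _ _ (Finset.mem_univ i)]
  congr 1
  · simp [coordLaw]
  · refine Finset.sum_congr rfl fun j hj => ?_
    simp [coordLaw, (Finset.ne_of_mem_erase hj).symm]

section

variable {μ π : Y → ℝ}

/-- Coordinates i and k both get the normalized geometric mean of μ and π, which ties U_i and U_k;
the others get π at no cost. -/
theorem exists_mem_errorRegion (hM : 2 ≤ M) (hπ : π ∈ stdSimplex ℝ Y)
    (hμ_pos : ∀ y, 0 < μ y) (hπ_pos : ∀ y, 0 < π y) (i : Fin M) :
    ∃ q ∈ errorRegion Y i,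
      totalEntropy q (coordLaw μ π (some i)) = 2 * bhattacharyya μ π := by
  have : Nontrivial (Fin M) := Fin.nontrivial_iff_two_le.2 hM
  obtain ⟨k, hk⟩ := exists_ne i
  obtain ⟨r, hr, hrB⟩ := exists_relEntropy_add_eq hμ_pos hπ hπ_pos
  refine ⟨fun j => if j = i ∨ j = k then r else π,
    ⟨fun j => by dsimp only; split_ifs <;> assumption, k, hk.symm, ?_⟩, ?_⟩
  · exact (statGap_self_of_eq (by simp)).le
  · rw [totalEntropy_coordLaw, Finset.sum_eq_single k]
    · simpa using hrB
    · intro j hj hjk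
      simp only [Finset.ne_of_mem_erase hj, hjk, or_self, if_false]
      exact relEntropy_self π
    · simp [hk]

theorem isLeast_errorExponent (hM : 2 ≤ M) (hπ : π ∈ stdSimplex ℝ Y)
    (hμ_pos : ∀ y, 0 < μ y) (hπ_pos : ∀ y, 0 < π y) (i : Fin M) :
    IsLeast ((fun q => totalEntropy q (coordLaw μ π (some i))) '' errorRegion Y i)
      (errorExponent μ π i) := by
  obtain ⟨q, hq, -⟩ := exists_mem_errorRegion hM hπ hμ_pos hπ_pos i
  exact ((isCompact_errorRegion i).image
    (continuous_totalEntropy (coordLaw_pos hμ_pos hπ_pos _))).isLeast_sInf ⟨_, q, hq, rfl⟩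

theorem errorExponent_le (hM : 2 ≤ M) (hπ : π ∈ stdSimplex ℝ Y)
    (hμ_pos : ∀ y, 0 < μ y) (hπ_pos : ∀ y, 0 < π y) (i : Fin M) :
    errorExponent μ π i ≤ 2 * bhattacharyya μ π := by
  obtain ⟨q, hq, h⟩ := exists_mem_errorRegion hM hπ hμ_pos hπ_pos i
  exact h ▸ (isLeast_errorExponent hM hπ hμ_pos hπ_pos i).2 ⟨q, hq, rfl⟩

theorem isLeast_exponentBound (hM : 2 ≤ M) (hμ : μ ∈ stdSimplex ℝ Y) (hπ : π ∈ stdSimplex ℝ Y)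
    (hμ_pos : ∀ y, 0 < μ y) (hπ_pos : ∀ y, 0 < π y) :
    IsLeast (boundValues μ π M) (exponentBound μ π M) ∧
      2 * bhattacharyya μ π ∈ boundValues μ π M := by
  have hM' : (2 : ℝ) ≤ M := by exact_mod_cast hM
  have hmem : 2 * bhattacharyya μ π ∈ boundValues μ π M := by
    refine ⟨π, hπ, ?_, rfl⟩
    rw [relEntropy_self]
    have h1 := bhattacharyya_nonneg hμ hπ
    have h2 : 0 ≤ logInvMin π := (relEntropy_self π).symm.le.trans
      (relEntropy_le_logInvMin hπ hπ_pos)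
    have : 0 ≤ (M : ℝ) - 1 := by linarith
    positivity
  have heq : boundValues μ π M = (fun q => 2 * bhattacharyya μ q) '' (stdSimplex ℝ Y ∩
      {q | relEntropy q π ≤ 1 / ((M : ℝ) - 1) * (2 * bhattacharyya μ π + logInvMin π)}) := by
    ext v
    simp only [boundValues, Set.mem_image, Set.mem_inter_iff, Set.mem_ofPred_eq, and_assoc, eq_comm]
  refine ⟨?_, hmem⟩
  rw [exponentBound]
  have hne : (boundValues μ π M).Nonempty := ⟨_, hmem⟩
  rw [heq] at hne ⊢
  refine IsCompact.isLeast_sInf (IsCompact.image_of_continuousOn ?_ ?_) hne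
  · exact (isCompact_stdSimplex ℝ Y).inter_right
      (isClosed_le (continuous_relEntropy_left hπ_pos) continuous_const)
  · exact ((continuousOn_bhattacharyya hμ_pos).const_smul (2 : ℝ)).mono Set.inter_subset_left

theorem exponentBound_le_errorExponent (hM : 2 ≤ M) (hμ : μ ∈ stdSimplex ℝ Y)
    (hπ : π ∈ stdSimplex ℝ Y) (hμ_pos : ∀ y, 0 < μ y) (hπ_pos : ∀ y, 0 < π y) (i : Fin M) :
    exponentBound μ π M ≤ errorExponent μ π i := by
  have hM' : (2 : ℝ) ≤ M := by exact_mod_cast hM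
  obtain ⟨q, ⟨hq, k, hik, hgap⟩, hqa⟩ := (isLeast_errorExponent hM hπ hμ_pos hπ_pos i).1
  have hle := errorExponent_le hM hπ hμ_pos hπ_pos i
  simp only [totalEntropy_coordLaw] at hqa
  have hgap' : divergenceStat q k ≤ divergenceStat q i := by
    rw [statGap, ← divergenceStat_sub hM hq hik] at hgap; linarith
  have hnn : ∀ j, 0 ≤ relEntropy (q j) π := fun j =>
    relEntropy_nonneg (hq j) hπ fun y hy => absurd hy (hπ_pos y).ne'
  have hmem : ∀ j, j ≠ k → j ∈ Finset.univ.erase k := fun j hj => by simp [hj]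
  have hbound : 2 * bhattacharyya μ (meanExcept q k) ∈ boundValues μ π M := by
    -- The sum over j ≠ k exceeds the one over j ≠ i by at most D(q_i‖π) ≤ C_π, and the latter is at
    -- most the exponent, hence at most 2B(μ, π).
    refine ⟨_, meanExcept_mem hM hq k, (relEntropy_meanExcept_le hM hq hπ_pos k).trans ?_, rfl⟩
    have : 0 < (M : ℝ) - 1 := by linarith
    refine mul_le_mul_of_nonneg_left ?_ (by positivity)
    have h1 := relEntropy_le_logInvMin (hq i) hπ_pos
    have h2 := relEntropy_nonneg (hq i) hμ fun y hy => absurd hy (hμ_pos y).ne'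
    have h3 := Finset.add_sum_erase Finset.univ (fun j => relEntropy (q j) π) (Finset.mem_univ i)
    have h4 := Finset.add_sum_erase Finset.univ (fun j => relEntropy (q j) π) (Finset.mem_univ k)
    have h5 := hnn k
    linarith
  refine ((isLeast_exponentBound hM hμ hπ hμ_pos hπ_pos).1.2 hbound).trans ?_
  have hac : ∀ j, j ≠ k → ∀ y, meanExcept q k y = 0 → q j y = 0 := fun j hj y hy =>
    eq_zero_of_meanExcept_eq_zero hM hq hj hy
  have h1 := two_mul_bhattacharyya_le (hq i) (meanExcept_mem hM hq k) hμ_pos (hac i hik)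
  have h2 : relEntropy (q i) (meanExcept q k) ≤ divergenceStat q k :=
    Finset.single_le_sum (f := fun j => relEntropy (q j) (meanExcept q k))
      (fun j hj => relEntropy_nonneg (hq j) (meanExcept_mem hM hq k)
        (hac j (Finset.ne_of_mem_erase hj))) (hmem i hik)
  have h3 := divergenceStat_le hM hq hπ hπ_pos i
  linarith

theorem tendsto_exponentBound (hμ : μ ∈ stdSimplex ℝ Y) (hπ : π ∈ stdSimplex ℝ Y)
    (hμ_pos : ∀ y, 0 < μ y) (hπ_pos : ∀ y, 0 < π y) :
    Tendsto (fun M : ℕ => exponentBound μ π M) atTop (𝓝 (2 * bhattacharyya μ π)) := by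
  have hex : ∀ M : ℕ, ∃ q, 2 ≤ M → q ∈ stdSimplex ℝ Y ∧
      relEntropy q π ≤ 1 / ((M : ℝ) - 1) * (2 * bhattacharyya μ π + logInvMin π) ∧
      exponentBound μ π M = 2 * bhattacharyya μ q := by
    intro M
    by_cases hM : 2 ≤ M
    · obtain ⟨q, h⟩ := (isLeast_exponentBound hM hμ hπ hμ_pos hπ_pos).1.1
      exact ⟨q, fun _ => h⟩
    · exact ⟨0, fun h => absurd h hM⟩
  choose q hq using hex
  have hlim : Tendsto (fun M : ℕ =>
      √(1 / ((M : ℝ) - 1) * (2 * bhattacharyya μ π + logInvMin π))) atTop (𝓝 0) := by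
    have h1 : Tendsto (fun M : ℕ => (M : ℝ) - 1) atTop atTop :=
      tendsto_atTop_add_const_right _ (-1) tendsto_natCast_atTop_atTop
    have h2 := (h1.inv_tendsto_atTop.mul_const (2 * bhattacharyya μ π + logInvMin π)).sqrt
    simpa using h2
  -- The Hellinger bound turns the divergence constraint of order 1/M into convergence of each √q to
  -- √π.
  have hsqrt : ∀ y, Tendsto (fun M => √(q M y)) atTop (𝓝 √(π y)) := by
    intro y
    rw [tendsto_iff_dist_tendsto_zero]
    refine squeeze_zero' (Eventually.of_forall fun _ => dist_nonneg) ?_ hlim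
    filter_upwards [eventually_ge_atTop 2] with M hM
    obtain ⟨h1, h2, -⟩ := hq M hM
    rw [Real.dist_eq]
    refine Real.abs_le_sqrt (le_trans ?_ h2)
    refine le_trans ?_ (hellinger_le_relEntropy h1 hπ fun y hy => absurd hy (hπ_pos y).ne')
    exact Finset.single_le_sum (f := fun y => (√(q M y) - √(π y)) ^ 2)
      (fun _ _ => sq_nonneg _) (Finset.mem_univ y)
  have hsum : Tendsto (fun M => ∑ y, √(μ y) * √(q M y)) atTop (𝓝 (∑ y, √(μ y) * √(π y))) :=
    tendsto_finsetSum _ fun y _ => (hsqrt y).const_mul _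
  have hB := ((hsum.log (sum_sqrt_mul_sqrt_pos hμ_pos hπ).ne').neg).const_mul 2
  refine hB.congr' ?_
  filter_upwards [eventually_ge_atTop 2] with M hM
  rw [(hq M hM).2.2, bhattacharyya]

/-- The types of cost at most the exponent minus η form a compact set disjoint from the error
region, so every gap has a positive minimum there. A small positive threshold therefore costs at
most η. -/
theorem exists_margin (hM : 2 ≤ M) (hπ : π ∈ stdSimplex ℝ Y)
    (hμ_pos : ∀ y, 0 < μ y) (hπ_pos : ∀ y, 0 < π y) (i : Fin M) {η : ℝ} (hη : 0 < η) :
    ∃ ε > 0, ∀ q : Fin M → Y → ℝ, (∀ j, q j ∈ stdSimplex ℝ Y) → ∀ k, i ≠ k →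
      statGap i k q ≤ ε → errorExponent μ π i - η ≤ totalEntropy q (coordLaw μ π (some i)) := by
  set L : Set (Fin M → Y → ℝ) := {q | ∀ j, q j ∈ stdSimplex ℝ Y} ∩
    {q | totalEntropy q (coordLaw μ π (some i)) ≤ errorExponent μ π i - η} with hL
  have hLc : IsCompact L := isCompact_product_simplex.inter_right
    (isClosed_le (continuous_totalEntropy (coordLaw_pos hμ_pos hπ_pos _)) continuous_const)
  have hk : ∀ k, ∀ᶠ ε : ℝ in 𝓝[>] 0, i ≠ k → ∀ q ∈ L, ε < statGap i k q := by
    intro k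
    by_cases hik : i ≠ k
    swap
    · exact Eventually.of_forall fun _ h => absurd h hik
    rcases L.eq_empty_or_nonempty with hem | hne
    · exact Eventually.of_forall fun _ _ q hq => by simp [hem] at hq
    obtain ⟨q0, hq0, hmin⟩ := hLc.exists_isMinOn hne (continuous_statGap i k).continuousOn
    have hpos : 0 < statGap i k q0 := by
      by_contra! hcon
      have := (isLeast_errorExponent hM hπ hμ_pos hπ_pos i).2
        ⟨q0, ⟨hq0.1, k, hik, hcon⟩, rfl⟩
      have h2 := hq0.2
      simp only [Set.mem_ofPred_eq] at h2
      linarith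
    filter_upwards [nhdsWithin_le_nhds (gt_mem_nhds hpos)] with ε hε _ q hq
    exact hε.trans_le (hmin hq)
  obtain ⟨ε, hε, hε0⟩ := ((eventually_all.2 hk).and self_mem_nhdsWithin).exists
  refine ⟨ε, hε0, fun q hq k hik hgap => ?_⟩
  by_contra! hcon
  exact absurd (hε k hik q ⟨hq, hcon.le⟩) (not_lt.2 hgap)

end

end OutlierTest

/-! ### Error probabilities of the test. -/

namespace OutlierTest

variable {Y : Type*} [Fintype Y] {M : ℕ} {μ π : Y → ℝ}

theorem nontrivial_of_ne (hμ : μ ∈ stdSimplex ℝ Y) (hπ : π ∈ stdSimplex ℝ Y) (h : μ ≠ π) :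
    Nontrivial Y := by
  by_contra hcon
  have := not_nontrivial_iff_subsingleton.1 hcon
  refine h (funext fun y => ?_)
  have h1 := hμ.2
  have h2 := hπ.2
  rw [Fintype.sum_subsingleton _ y] at h1 h2
  rw [h1, h2]

theorem errorProb_eq {n : ℕ} (δ : (Fin M → Fin n → Y) → Option (Fin M)) (h : Option (Fin M)) :
    errorProb μ π δ h = ∑ y with δ y ≠ h, productPmf (coordLaw μ π h) y := by
  rw [errorProb, jointPmf_eq]

variable [DecidableEq Y]

theorem stat_eq {n : ℕ} (y : Fin M → Fin n → Y) (i : Fin M) :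
    stat y i = divergenceStat (fun j => empirical (y j)) i := rfl

theorem stat_sub {n : ℕ} (hM : 2 ≤ M) (hn : n ≠ 0) (y : Fin M → Fin n → Y) {i k : Fin M}
    (h : i ≠ k) : stat y k - stat y i = statGap i k fun j => empirical (y j) := by
  rw [stat_eq, stat_eq, divergenceStat_sub hM (fun j => empirical_mem hn _) h]; rfl

/-- A wrong non-null decision picks a minimizer k ≠ i, with gap at most 0; a null decision bounds
all gaps by t. The absolute value covers both, as t may be negative. -/
theorem IsNullAugmentedTest.exists_le_of_ne {n : ℕ} {t : ℝ}
    {δ : (Fin M → Fin n → Y) → Option (Fin M)} (hδ : IsNullAugmentedTest t δ) (hM : 2 ≤ M)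
    {y : Fin M → Fin n → Y} {i : Fin M} (h : δ y ≠ some i) :
    ∃ k, i ≠ k ∧ stat y k - stat y i ≤ |t| := by
  by_cases hex : ∃ j k : Fin M, j ≠ k ∧ t < stat y j - stat y k
  · obtain ⟨k, hk, hmin⟩ := (hδ y).1 hex
    refine ⟨k, fun e => h (e ▸ hk), ?_⟩
    have := hmin i
    have := abs_nonneg t
    linarith
  · have : Nontrivial (Fin M) := Fin.nontrivial_iff_two_le.2 hM
    obtain ⟨k, hk⟩ := exists_ne i
    refine ⟨k, hk.symm, ?_⟩
    by_contra! hcon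
    exact hex ⟨k, i, hk, (le_abs_self t).trans_lt hcon⟩

/-- This holds for every threshold, so the lower bound on the error probability needs nothing about
λ_n. -/
theorem IsNullAugmentedTest.ne_of_lt {n : ℕ} {t : ℝ}
    {δ : (Fin M → Fin n → Y) → Option (Fin M)} (hδ : IsNullAugmentedTest t δ)
    {y : Fin M → Fin n → Y} {i k : Fin M} (h : stat y k < stat y i) : δ y ≠ some i := by
  intro e
  by_cases hex : ∃ j k : Fin M, j ≠ k ∧ t < stat y j - stat y k
  · obtain ⟨l, hl, hmin⟩ := (hδ y).1 hex
    rw [e, Option.some_inj] at hl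
    exact absurd (hmin k) (by rw [← hl]; exact not_le.2 h)
  · simpa [e] using (hδ y).2 hex

theorem eventually_errorProb_le (hM : 2 ≤ M) (hπ : π ∈ stdSimplex ℝ Y)
    (hμ_pos : ∀ y, 0 < μ y) (hπ_pos : ∀ y, 0 < π y) {t : ℕ → ℝ} (ht : Tendsto t atTop (𝓝 0))
    {δ : (n : ℕ) → (Fin M → Fin n → Y) → Option (Fin M)}
    (hδ : ∀ n, IsNullAugmentedTest (t n) (δ n)) (i : Fin M) {η : ℝ} (hη : 0 < η) :
    ∀ᶠ n : ℕ in atTop, errorProb μ π (δ n) (some i) ≤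
      ((n : ℝ) + 1) ^ (Fintype.card Y * M) *
        Real.exp (-(n * (errorExponent μ π i - η))) := by
  obtain ⟨ε, hε, hmargin⟩ := exists_margin hM hπ hμ_pos hπ_pos i hη
  have ht' := ht.abs
  rw [abs_zero] at ht'
  filter_upwards [ht'.eventually (gt_mem_nhds hε), eventually_ne_atTop 0] with n hnt hn
  rw [errorProb_eq]
  refine sum_productPmf_le hn (coordLaw_pos hμ_pos hπ_pos _) _ fun y hy => ?_
  obtain ⟨k, hik, hk⟩ := (hδ n).exists_le_of_ne hM (Finset.mem_filter.1 hy).2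
  rw [stat_sub hM hn y hik] at hk
  exact hmargin _ (fun j => empirical_mem hn _) k hik (hk.trans hnt.le)

theorem eventually_le_errorProb [Nontrivial Y] (hM : 3 ≤ M)
    (hπ : π ∈ stdSimplex ℝ Y) (hμ_pos : ∀ y, 0 < μ y) (hπ_pos : ∀ y, 0 < π y) {t : ℕ → ℝ}
    {δ : (n : ℕ) → (Fin M → Fin n → Y) → Option (Fin M)}
    (hδ : ∀ n, IsNullAugmentedTest (t n) (δ n)) (i : Fin M) {η : ℝ} (hη : 0 < η) :
    ∀ᶠ n : ℕ in atTop, 1 / 2 * Real.exp (-(n * (errorExponent μ π i + η))) ≤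
      errorProb μ π (δ n) (some i) := by
  have hM2 : 2 ≤ M := by omega
  set P := coordLaw (M := M) μ π (some i) with hP
  set a := errorExponent μ π i with ha
  have hP0 : ∀ j b, 0 < P j b := coordLaw_pos hμ_pos hπ_pos _
  obtain ⟨q0, ⟨hq0, k, hik, hgap⟩, hq0a⟩ := (isLeast_errorExponent hM2 hπ hμ_pos hπ_pos i).1
  simp only [← hP, ← ha] at hq0a
  obtain ⟨c, hc, hc0, hcneg⟩ := exists_path_statGap_neg hM hq0 hik hgap
  have hlim : Tendsto (fun s => totalEntropy (c s) P) (𝓝[>] 0) (𝓝 a) := by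
    have := ((continuous_totalEntropy hP0).comp hc).tendsto 0
    simp only [Function.comp_apply, hc0, hq0a] at this
    exact this.mono_left nhdsWithin_le_nhds
  obtain ⟨s, hs, hs0, hs1⟩ := ((hlim.eventually (gt_mem_nhds (show a < a + η by linarith))).and
    (Ioo_mem_nhdsGT (zero_lt_one' ℝ))).exists
  obtain ⟨hq, hqneg⟩ := hcneg s hs0 hs1
  set q := c s with hqdef
  have hopen : IsOpen ({γ | statGap i k γ < 0} ∩ {γ | logRatio q P γ < a + η}) :=
    (isOpen_lt (continuous_statGap i k) continuous_const).inter
      (isOpen_lt (continuous_logRatio q P) continuous_const)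
  -- At γ = q the log-likelihood ratio is the total entropy of q, which is what `hs` bounds.
  obtain ⟨ε, hε, hball⟩ := Metric.isOpen_iff.1 hopen q ⟨hqneg, hs⟩
  have hsmall := ((tendsto_const_div_atTop_nhds_zero_nat
    ((M : ℝ) * Fintype.card Y / ε ^ 2))).eventually
    (gt_mem_nhds (show (0 : ℝ) < 1 / 2 by norm_num))
  filter_upwards [hsmall, eventually_ne_atTop 0] with n hn12 hn
  have hgood : ∀ y : Fin M → Fin n → Y, (∀ j b, |empirical (y j) b - q j b| < ε) →
      δ n y ≠ some i ∧ logRatio q P (fun j => empirical (y j)) < a + η := by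
    intro y hy
    have hmem := hball (a := fun j => empirical (y j)) (by
      rw [Metric.mem_ball, dist_pi_lt_iff hε]
      exact fun j => (dist_pi_lt_iff hε).2 fun b => hy j b)
    refine ⟨(hδ n).ne_of_lt (k := k) ?_, hmem.2⟩
    have h1 : statGap i k (fun j => empirical (y j)) < 0 := hmem.1
    rw [← stat_sub hM2 hn y hik] at h1
    linarith
  rw [errorProb_eq, ← hP]
  have hP0' := productPmf_nonneg (n := n) fun j b => (hP0 j b).le
  have hcheb := one_sub_le_sum_productPmf hn hq hε
  -- Under the perturbed law q, types near q, all of them errors, have probability at least 1/2.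
  have hhalf : (1 : ℝ) / 2 ≤ ∑ y : Fin M → Fin n → Y with
      ∀ j b, |empirical (y j) b - q j b| < ε, productPmf q y := by
    refine le_trans ?_ hcheb
    rw [div_div, mul_comm (ε ^ 2)] at hn12
    linarith
  calc 1 / 2 * Real.exp (-(n * (a + η)))
      ≤ ∑ y : Fin M → Fin n → Y with ∀ j b, |empirical (y j) b - q j b| < ε,
          productPmf q y * Real.exp (-(n * (a + η))) := by
        rw [← Finset.sum_mul]
        exact mul_le_mul_of_nonneg_right hhalf (Real.exp_pos _).le
    _ ≤ ∑ y : Fin M → Fin n → Y with ∀ j b, |empirical (y j) b - q j b| < ε,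
          productPmf P y := by
        refine Finset.sum_le_sum fun y hy => ?_
        refine le_trans ?_ (productPmf_mul_exp_le (fun j => (hq j).1) hP0 y)
        refine mul_le_mul_of_nonneg_left (Real.exp_le_exp.2 ?_)
          (productPmf_nonneg (fun j => (hq j).1) y)
        have := mul_le_mul_of_nonneg_left (hgood y (Finset.mem_filter.1 hy).2).2.le
          (Nat.cast_nonneg (α := ℝ) n)
        linarith
    _ ≤ _ := Finset.sum_le_sum_of_subset_of_nonneg (fun y hy => by
          simp only [Finset.mem_filter, Finset.mem_univ, true_and] at hy ⊢
          exact (hgood y hy).1) fun y _ _ => hP0' y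

/-- U_k ≥ 0, and U_j is at most the divergence from the common reference π. -/
theorem stat_sub_le_chiSq {n : ℕ} (hM : 2 ≤ M) (hn : n ≠ 0) (hπ : π ∈ stdSimplex ℝ Y)
    (hπ_pos : ∀ y, 0 < π y) (y : Fin M → Fin n → Y) (j k : Fin M) :
    stat y j - stat y k ≤ ∑ l, ∑ a, (empirical (y l) a - π a) ^ 2 / π a := by
  have hq : ∀ l, empirical (y l) ∈ stdSimplex ℝ Y := fun l => empirical_mem hn _
  have h1 : 0 ≤ stat y k := divergenceStat_nonneg hM hq k
  have h2 : stat y j ≤ ∑ l ∈ Finset.univ.erase j, relEntropy (empirical (y l)) π :=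
    divergenceStat_le hM hq hπ hπ_pos j
  have h3 : ∑ l ∈ Finset.univ.erase j, relEntropy (empirical (y l)) π ≤
      ∑ l, relEntropy (empirical (y l)) π :=
    Finset.sum_le_sum_of_subset_of_nonneg (Finset.erase_subset _ _) fun l _ _ =>
      relEntropy_nonneg (hq l) hπ fun a ha => absurd ha (hπ_pos a).ne'
  have h4 := Finset.sum_le_sum fun l (_ : l ∈ Finset.univ) =>
    relEntropy_le_chiSq (hq l) hπ hπ_pos
  linarith

/-- Markov's inequality for the chi-squared statistic, each squared deviation having mean at most
1/n. -/
theorem errorProb_none_le {n : ℕ} (hM : 2 ≤ M) (hn : n ≠ 0) (hπ : π ∈ stdSimplex ℝ Y)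
    (hπ_pos : ∀ y, 0 < π y) {t : ℝ} (ht : 0 < t) {δ : (Fin M → Fin n → Y) → Option (Fin M)}
    (hδ : IsNullAugmentedTest t δ) :
    errorProb μ π δ none ≤ M * (∑ a, 1 / π a) / (n * t) := by
  have hlaw : coordLaw (M := M) μ π none = fun _ => π := by funext j; simp [coordLaw]
  rw [errorProb_eq, hlaw]
  have h0 := productPmf_nonneg (M := M) (n := n) fun _ => hπ.1
  have hW : ∀ y : Fin M → Fin n → Y,
      0 ≤ ∑ l, ∑ a, (empirical (y l) a - π a) ^ 2 / π a := fun y =>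
    Finset.sum_nonneg fun l _ => Finset.sum_nonneg fun a _ =>
      div_nonneg (sq_nonneg _) (hπ_pos a).le
  calc ∑ y with δ y ≠ none, productPmf (fun _ => π) y
      ≤ ∑ y with δ y ≠ none, productPmf (fun _ => π) y *
          (∑ l, ∑ a, (empirical (y l) a - π a) ^ 2 / π a) / t := by
        refine Finset.sum_le_sum fun y hy => ?_
        have hex : ∃ j k : Fin M, j ≠ k ∧ t < stat y j - stat y k := by
          by_contra hcon
          exact (Finset.mem_filter.1 hy).2 ((hδ y).2 hcon)
        obtain ⟨j, k, -, hjk⟩ := hex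
        rw [le_div_iff₀ ht]
        exact mul_le_mul_of_nonneg_left
          (hjk.le.trans (stat_sub_le_chiSq hM hn hπ hπ_pos y j k)) (h0 y)
    _ ≤ ∑ y, productPmf (fun _ => π) y *
          (∑ l, ∑ a, (empirical (y l) a - π a) ^ 2 / π a) / t :=
        Finset.sum_le_sum_of_subset_of_nonneg (Finset.subset_univ _) fun y _ _ =>
          div_nonneg (mul_nonneg (h0 y) (hW y)) ht.le
    _ = (∑ l, ∑ a, (∑ y : Fin M → Fin n → Y, productPmf (fun _ => π) y *
          (empirical (y l) a - π a) ^ 2) / π a) / t := by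
        rw [← Finset.sum_div]
        simp only [Finset.mul_sum, Finset.sum_div, mul_div_assoc]
        rw [Finset.sum_comm]
        exact Finset.sum_congr rfl fun l _ => Finset.sum_comm
    _ ≤ (∑ _l : Fin M, ∑ a, 1 / n / π a) / t := by
        refine div_le_div_of_nonneg_right (Finset.sum_le_sum fun l _ =>
          Finset.sum_le_sum fun a _ => div_le_div_of_nonneg_right ?_ (hπ_pos a).le) ht.le
        exact sum_productPmf_mul_sq_le hn (fun _ => hπ) l a
    _ = _ := by
        simp only [div_eq_mul_inv, one_mul, ← Finset.mul_sum, Finset.sum_const, Finset.card_univ,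
          Fintype.card_fin, nsmul_eq_mul, mul_inv]
        ring

end OutlierTest

/-! ### Assembly of the statement. -/

theorem corollary6 {Y : Type*} [Fintype Y] [DecidableEq Y]
    (thr : ℕ → ℕ → ℝ)
    (hthr : ∀ M : ℕ, 3 ≤ M →
      (fun n : ℕ => thr M n) =O[atTop] (fun n : ℕ => Real.log n / (n : ℝ)))
    (δ : (M n : ℕ) → (Fin M → Fin n → Y) → Option (Fin M))
    (hδ : ∀ M : ℕ, 3 ≤ M → ∀ n : ℕ, OutlierTest.IsNullAugmentedTest (thr M n) (δ M n))
    (μ π : Y → ℝ) (hμ : μ ∈ stdSimplex ℝ Y) (hπ : π ∈ stdSimplex ℝ Y)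
    (hμ_pos : ∀ y, 0 < μ y) (hπ_pos : ∀ y, 0 < π y) (hne : μ ≠ π) :
    -- `C_π` is finite, and the minimum that defines the lower bound is attained
    0 < (⨅ y, π y) ∧
    (∀ M : ℕ, 3 ≤ M →
      IsLeast (OutlierTest.boundValues μ π M) (OutlierTest.exponentBound μ π M)) ∧
    -- the exponents under the non-null hypotheses, their lower bound, and the limits as `M → ∞`
    (∃ α : (M : ℕ) → Fin M → ℝ,
      (∀ M : ℕ, 3 ≤ M → ∀ i : Fin M,
        OutlierTest.HasExponent
          (fun n => OutlierTest.errorProb μ π (δ M n) (some i)) (α M i) ∧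
        OutlierTest.exponentBound μ π M ≤ α M i) ∧
      (∀ ε : ℝ, 0 < ε → ∀ᶠ M : ℕ in atTop, ∀ i : Fin M,
        |α M i - 2 * OutlierTest.bhattacharyya μ π| < ε)) ∧
    Tendsto (fun M : ℕ => OutlierTest.exponentBound μ π M) atTop
      (𝓝 (2 * OutlierTest.bhattacharyya μ π)) ∧
    -- consistency under the null hypothesis
    (∀ M : ℕ, 3 ≤ M →
      (∃ c : ℝ, 0 < c ∧ ∀ᶠ n : ℕ in atTop, c * (Real.log n / (n : ℝ)) ≤ thr M n) →
      Tendsto (fun n : ℕ => OutlierTest.errorProb μ π (δ M n) none) atTop (𝓝 0)) := by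
  -- The perturbation of ties needs at least two letters; this is where μ ≠ π enters.
  have hnt := OutlierTest.nontrivial_of_ne hμ hπ hne
  have hlim := OutlierTest.tendsto_exponentBound hμ hπ hμ_pos hπ_pos
  refine ⟨OutlierTest.iInf_pos_of_forall_pos hπ_pos, fun M hM =>
    (OutlierTest.isLeast_exponentBound (by omega) hμ hπ hμ_pos hπ_pos).1,
    ⟨fun M i => OutlierTest.errorExponent μ π i, fun M hM i => ⟨?_, ?_⟩, fun ε hε => ?_⟩, hlim,
    fun M hM ⟨c, hc, hcthr⟩ => ?_⟩
  · exact OutlierTest.hasExponent_of_bounds (Fintype.card Y * M)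
      (fun η hη => OutlierTest.eventually_le_errorProb hM hπ hμ_pos hπ_pos (hδ M hM) i hη)
      (fun η hη => OutlierTest.eventually_errorProb_le (by omega) hπ hμ_pos hπ_pos
        ((hthr M hM).trans_tendsto OutlierTest.tendsto_log_div_natCast) (hδ M hM) i hη)
  · exact OutlierTest.exponentBound_le_errorExponent (by omega) hμ hπ hμ_pos hπ_pos i
  -- The exponent lies between `exponentBound` and 2B(μ, π), neither of which depends on i; hence
  -- the uniformity.
  · filter_upwards [hlim.eventually (lt_mem_nhds (sub_lt_self _ hε)), eventually_ge_atTop 2]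
      with M hMε hM i
    have h1 := OutlierTest.exponentBound_le_errorExponent hM hμ hπ hμ_pos hπ_pos i
    have h2 := OutlierTest.errorExponent_le hM hπ hμ_pos hπ_pos i
    rw [abs_lt]
    constructor <;> linarith
  · set K : ℝ := M * (∑ a, 1 / π a) with hK
    have hK0 : 0 ≤ K := mul_nonneg (Nat.cast_nonneg M)
      (Finset.sum_nonneg fun a _ => one_div_nonneg.2 (hπ_pos a).le)
    have hlog : Tendsto (fun n : ℕ => c * Real.log n) atTop atTop :=
      (Real.tendsto_log_atTop.comp tendsto_natCast_atTop_atTop).const_mul_atTop hc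
    refine squeeze_zero' (Eventually.of_forall fun n => ?_) ?_ (hlog.const_div_atTop K)
    · rw [OutlierTest.errorProb_eq]
      exact Finset.sum_nonneg fun y _ => OutlierTest.productPmf_nonneg
        (fun j a => (OutlierTest.coordLaw_pos hμ_pos hπ_pos _ j a).le) y
    -- From n = 2 on, log n > 0 makes the threshold positive, and K / (n λ_n) ≤ K / (c log n).
    · filter_upwards [hcthr, eventually_ge_atTop 2] with n hn hn2
      have hn0 : (0 : ℝ) < n := by positivity
      have hl : 0 < Real.log n := Real.log_pos (by exact_mod_cast hn2)
      have ht : 0 < thr M n := lt_of_lt_of_le (by positivity) hn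
      refine (OutlierTest.errorProb_none_le (by omega) (by omega) hπ hπ_pos ht (hδ M hM n)).trans ?_
      refine div_le_div_of_nonneg_left hK0 (by positivity) ?_
      calc c * Real.log n = n * (c * (Real.log n / n)) := by field_simp
        _ ≤ n * thr M n := mul_le_mul_of_nonneg_left hn hn0.le
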